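/- Let $A=\mathbb C^n/\Gamma$ be a complex torus of dimension $n$, and let $N\to A$ be the holomorphic line bundle given by multipliers $e_\lambda\in\mathcal O^*(\mathbb C^n)$, $\lambda\in\Gamma$, with $e_{\mu}(z+\lambda)e_\lambda(z)=e_{\lambda+\mu}(z)$; thus $N=(\mathbb C\times\mathbb C^n)/\Gamma$ for the action $\lambda\cdot(w,z)=(e_\lambda(z)w,\,z+\lambda)$ (every holomorphic line bundle on $A$ is of this form). Let $h$ be a smooth Hermitian metric on $N$, i.e. a smooth function $h>0$ on $\mathbb C^n$ with $h(z+\lambda)|e_\lambda(z)|^2=h(z)$, such that $\omega_A=\sqrt{-1}\,\partial\bar\partial\log h$ is positive definite (so that $N$ is negative and $A$ is an abelian variety) and Ricci-flat. Let $r=|w|^2h(z)$ be the norm function on $N$ and $D=\{0<r<1\}\subset N$ the punctured unit disc bundle; contracting the zero section identifies $D$ with a punctured neighbourhood of the singular point of the cone over $A$. Let $H=\{(u,z)\in\mathbb C\times\mathbb C^n:-\operatorname{Im}u+\log h(z)<0\}$, with the covering map $H\to D$ induced by $(u,z)\mapsto(e^{iu/2},z)$. The Bergman metric of a domain is $\sqrt{-1}\,\partial\bar\partial\log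 K(z,z)$, where $K$ is its Bergman kernel. 1. (Coincidence of the two metrics.) $H$ is biholomorphic to the unit ball $\mathbb B^{n+1}\subset\mathbb C^{n+1}$, and there is exactly one metric $\omega_{\mathrm{ball}}$ on $D$ whose pull-back under $\mathbb B^{n+1}\to H\to D$ is the Bergman metric of $\mathbb B^{n+1}$, for every biholomorphism $\mathbb B^{n+1}\to H$. It equals the Calabi Ansatz metric $$\omega_{\mathrm{Cal}}=\omega_A+\sqrt{-1}\,\partial\bar\partial\rho(r),\qquad \rho(r)=-(n+2)\log|\log r|-\log r,$$ where $\omega_A$ is pulled back to $D$, and on $D$ $$\omega_{\mathrm{ball}}=\omega_{\mathrm{Cal}}=-(n+2)\,\sqrt{-1}\,\partial\bar\partial\log|\log r|.$$ 2. (The classical explicit metric.) Suppose that $N$ is in normal form: $\Gamma$ is spanned over $\mathbb Z$ by $\lambda_\alpha=\delta_\alpha e_\alpha$ with nonzero integers $\delta_\alpha$, where $e_\alpha$ are the standard basis vectors, and by the columns $\lambda_{n+\alpha}$ of a symmetric matrix $Z$ with $Y=-\operatorname{Im}Z$ positive definite, and for some $t\in\mathbb C^n$ the multipliers are $e_{\lambda_\alpha}=1$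 and $e_{\lambda_{n+\alpha}}(z)=e^{-2\pi i(z_\alpha-t_\alpha)}$ for $1\le\alpha\le n$. Put $W=Y^{-1}$ and $c_\alpha=z_\alpha-\bar z_\alpha+iY_{\alpha\alpha}-t_\alpha+\bar t_\alpha$. Then $$h(z)=\exp\Big(-\frac{\pi}{2}\sum_{\alpha,\beta}W_{\alpha\beta}c_\alpha c_\beta\Big)$$ is a smooth Hermitian metric on $N$ for which $\sqrt{-1}\,\partial\bar\partial\log h$ is positive definite and Ricci-flat, so that part 1 applies to it. -/

import Mathlib

/-! ### Levi forms -/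

section Levi

variable {E : Type*} [NormedAddCommGroup E] [NormedSpace ℂ E]

/-- The derivative of type `(1,0)` in the direction `v`: `∂f (v) = ∑ⱼ (∂f/∂zⱼ) vⱼ`. -/
noncomputable def delD (f : E → ℂ) (v p : E) : ℂ :=
  (1 / 2 : ℂ) * (fderiv ℝ f p v - Complex.I * fderiv ℝ f p (Complex.I • v))

/-- The derivative of type `(0,1)` in the direction `v`: `∂̄f (v) = ∑ⱼ (∂f/∂z̄ⱼ) v̄ⱼ`. -/
noncomputable def delbarD (f : E → ℂ) (v p : E) : ℂ :=
  (1 / 2 : ℂ) * (fderiv ℝ f p v + Complex.I * fderiv ℝ f p (Complex.I • v))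

/-- The Hermitian form of the real `(1,1)`-form `√-1 ∂∂̄ f`:
`leviForm f p v w = ∑ⱼₖ (∂²f/∂zⱼ∂z̄ₖ)(p) vⱼ w̄ₖ`. -/
noncomputable def leviForm (f : E → ℝ) (p v w : E) : ℂ :=
  delD (fun q => delbarD (fun x => (f x : ℂ)) w q) v p

/-- `F` is biholomorphic from `S` onto `T`. -/
def IsBiholomorphism (F : E → E) (S T : Set E) : Prop :=
  DifferentiableOn ℂ F S ∧ Set.MapsTo F S T ∧
    ∃ G : E → E, DifferentiableOn ℂ G T ∧ Set.MapsTo G T S ∧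
      Set.LeftInvOn G F S ∧ Set.LeftInvOn F G T

end Levi

/-! ### Bergman kernel and Bergman metric of a domain -/

section Bergman

/-- The space `ℂ^{n+1}`, with coordinates `(w, z)`, `w ∈ ℂ`, `z ∈ ℂⁿ`. -/
abbrev CSpace (n : ℕ) : Type := ℂ × (Fin n → ℂ)

variable {n : ℕ}

/-- The unit ball of `ℂ^{n+1}` (for the Euclidean norm). -/
def unitBall (n : ℕ) : Set (CSpace n) :=
  {p | ‖p.1‖ ^ 2 + ∑ i, ‖p.2 i‖ ^ 2 < 1}

/-- `f` restricts to an element of the Bergman space `A²(Ω)`. -/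
def MemBergmanSpace (Ω : Set (CSpace n)) (f : CSpace n → ℂ) : Prop :=
  DifferentiableOn ℂ f Ω ∧
    MeasureTheory.MemLp f 2 (MeasureTheory.volume.restrict Ω)

/-- `K` is the reproducing kernel of `A²(Ω)` (only its values on `Ω × Ω` matter; they are unique). -/
def IsBergmanKernel (Ω : Set (CSpace n)) (K : CSpace n → CSpace n → ℂ) : Prop :=
  ∀ z ∈ Ω, MemBergmanSpace Ω (fun x => K x z) ∧
    ∀ f : CSpace n → ℂ, MemBergmanSpace Ω f →
      f z = ∫ x in Ω, f x * (starRingEnd ℂ) (K x z)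

/-- The Bergman kernel of `Ω`. -/
noncomputable def bergmanKernel (Ω : Set (CSpace n)) : CSpace n → CSpace n → ℂ :=
  Classical.epsilon (IsBergmanKernel Ω)

/-- The Bergman metric of `Ω`, `√-1 ∂∂̄ log K(z,z)`. -/
noncomputable def bergmanMetric (Ω : Set (CSpace n)) (p v w : CSpace n) : ℂ :=
  leviForm (fun z => Real.log (bergmanKernel Ω z z).re) p v w

end Bergman

/-! ### Line bundles on a complex torus -/

/-- A holomorphic line bundle on the complex torus `A = ℂⁿ/Γ`, given by its multipliers
`e_l ∈ 𝒪*(ℂⁿ)`, `l ∈ Γ`. The total space is the quotient of `ℂ × ℂⁿ` by the action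
`l • (w, z) = (e_l(z) w, z + l)` of `Γ`. -/
structure TorusLineBundle {n : ℕ} (Γ : Submodule ℤ (Fin n → ℂ)) where
  /-- the multipliers -/
  e : Γ → (Fin n → ℂ) → ℂ
  holomorphic : ∀ l, Differentiable ℂ (e l)
  ne_zero : ∀ l z, e l z ≠ 0
  cocycle : ∀ (l m : Γ) (z : Fin n → ℂ), e m (z + l) * e l z = e (l + m) z

namespace TorusLineBundle

variable {n : ℕ} {Γ : Submodule ℤ (Fin n → ℂ)}

/-- The action of the lattice on `ℂ × ℂⁿ`, whose quotient is the total space of the bundle. -/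
def act (N : TorusLineBundle Γ) (l : Γ) (p : CSpace n) : CSpace n :=
  (N.e l p.2 * p.1, p.2 + (l : Fin n → ℂ))

/-- A smooth Hermitian metric on the line bundle: the squared length of the vector with
coordinate `w` over `z` is `|w|² h(z)`. -/
structure HermitianMetric (N : TorusLineBundle Γ) where
  /-- the local weight -/
  h : (Fin n → ℂ) → ℝ
  smooth : ContDiff ℝ (⊤ : ℕ∞) h
  pos : ∀ z, 0 < h z
  invariant : ∀ (l : Γ) (z : Fin n → ℂ), h (z + l) * ‖N.e l z‖ ^ 2 = h z

namespace HermitianMetric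

variable {N : TorusLineBundle Γ}

/-- `ω_M = √-1 ∂∂̄ log h`, the negative of the curvature form of the line bundle, as a field of
Hermitian forms on `ℂⁿ` (it is `Γ`-invariant, hence lives on the torus). -/
noncomputable def baseForm (ρ : HermitianMetric N) (z v w : Fin n → ℂ) : ℂ :=
  leviForm (fun x => Real.log (ρ.h x)) z v w

/-- The coefficient matrix of `ω_M` in the standard coordinates. -/
noncomputable def baseMatrix (ρ : HermitianMetric N) (z : Fin n → ℂ) :
    Matrix (Fin n) (Fin n) ℂ :=
  Matrix.of fun j k => ρ.baseForm z (Pi.single j 1) (Pi.single k 1)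

/-- The line bundle is negatively curved: `ω_M` is positive definite, hence a Kähler metric. -/
def IsNegative (ρ : HermitianMetric N) : Prop :=
  ∀ z v : Fin n → ℂ, v ≠ 0 → 0 < (ρ.baseForm z v v).re

/-- The Ricci form of `ω_M`, i.e. `-√-1 ∂∂̄ log det ω_M`. -/
noncomputable def ricciForm (ρ : HermitianMetric N) (z v w : Fin n → ℂ) : ℂ :=
  - leviForm (fun x => Real.log (ρ.baseMatrix x).det.re) z v w

/-- `ω_M` is Ricci-flat. -/
def IsRicciFlat (ρ : HermitianMetric N) : Prop :=
  ∀ z v w : Fin n → ℂ, ρ.ricciForm z v w = 0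

/-- The norm function `r = |w|² h(z)` on the line bundle. -/
noncomputable def normFun (ρ : HermitianMetric N) (p : CSpace n) : ℝ :=
  ‖p.1‖ ^ 2 * ρ.h p.2

/-- The preimage in `ℂ × ℂⁿ` of the punctured disc bundle `D = {0 < r < 1}`. -/
def discBundle (ρ : HermitianMetric N) : Set (CSpace n) :=
  {p | 0 < ρ.normFun p ∧ ρ.normFun p < 1}

/-- The universal cover `H = {(u, z) | -Im u + log h(z) < 0}` of the punctured disc bundle. -/
def cover (ρ : HermitianMetric N) : Set (CSpace n) :=
  {p | -p.1.im + Real.log (ρ.h p.2) < 0}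

/-- `g` is a tensor field on `D = discBundle / Γ`, that is, `Γ`-invariant on `discBundle`. -/
def IsTensorOnDiscBundle (ρ : HermitianMetric N)
    (g : CSpace n → CSpace n → CSpace n → ℂ) : Prop :=
  ∀ (l : Γ), ∀ p ∈ ρ.discBundle, ∀ v w : CSpace n,
    g (N.act l p) (fderiv ℂ (N.act l) p v) (fderiv ℂ (N.act l) p w) = g p v w

end HermitianMetric

end TorusLineBundle

/-- The exponential map `(u, z) ↦ (e^{iu/2}, z)`. -/
noncomputable def expCover {n : ℕ} (p : CSpace n) : CSpace n :=
  (Complex.exp (Complex.I / 2 * p.1), p.2)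

namespace TorusLineBundle

variable {n : ℕ} {Γ : Submodule ℤ (Fin n → ℂ)} {N : TorusLineBundle Γ}

namespace HermitianMetric

/-- `g` is the metric on `D` induced from the Bergman metric of the unit ball: the universal cover
`H` of `D` is biholomorphic to the ball, and under every such identification `F` the pull-back of
`g` by the covering map `ball → H → D` is the Bergman metric. -/
def IsBallQuotientMetric (ρ : HermitianMetric N)
    (g : CSpace n → CSpace n → CSpace n → ℂ) : Prop :=
  ρ.IsTensorOnDiscBundle g ∧
  (∃ F, IsBiholomorphism F (unitBall n) ρ.cover) ∧
  ∀ F, IsBiholomorphism F (unitBall n) ρ.cover →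
    ∀ p ∈ unitBall n, ∀ v w : CSpace n,
      g (expCover (F p)) (fderiv ℂ (fun x => expCover (F x)) p v)
        (fderiv ℂ (fun x => expCover (F x)) p w) = bergmanMetric (unitBall n) p v w

/-- The one-variable function of the Calabi Ansatz, `-(n+2) log|log r| - log r`. -/
noncomputable def calabiPotential (n : ℕ) (r : ℝ) : ℝ :=
  -((n : ℝ) + 2) * Real.log |Real.log r| - Real.log r

/-- The Calabi Ansatz metric: the pull-back of `ω_M` to the total space plus
`√-1 ∂∂̄` of the potential evaluated at `r`. -/
noncomputable def calabiMetric (ρ : HermitianMetric N) (p v w : CSpace n) : ℂ :=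
  ρ.baseForm p.2 v.2 w.2 + leviForm (fun q => calabiPotential n (ρ.normFun q)) p v w

end HermitianMetric

/-- The line bundle `N` on `ℂⁿ/Γ` is in the classical normal form: `Γ` is spanned by
`l_a = δ_a e_a` and by the columns `l_{n+a}` of a symmetric matrix `Z` with `-Im Z` positive
definite, and the multipliers are `1` for `l_a` and `exp(-2πi(z_a - t_a))` for `l_{n+a}`. -/
structure IsNormalForm (N : TorusLineBundle Γ) (δ : Fin n → ℤ)
    (Z : Matrix (Fin n) (Fin n) ℂ) (t : Fin n → ℂ) : Prop where
  delta_ne_zero : ∀ a, δ a ≠ 0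
  symm : Z.IsSymm
  posDef : (Matrix.of fun a b => -(Z a b).im : Matrix (Fin n) (Fin n) ℝ).PosDef
  span_eq : Γ = Submodule.span ℤ
    (Set.range (fun a => (Pi.single a ((δ a : ℤ) : ℂ) : Fin n → ℂ)) ∪
      Set.range (fun a => (fun b => Z b a : Fin n → ℂ)))
  mult_one : ∀ (a : Fin n) (l : Γ), (l : Fin n → ℂ) = Pi.single a ((δ a : ℤ) : ℂ) →
    ∀ z, N.e l z = 1
  mult_exp : ∀ (a : Fin n) (l : Γ), (l : Fin n → ℂ) = (fun b => Z b a) →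
    ∀ z, N.e l z = Complex.exp (-2 * (Real.pi : ℂ) * Complex.I * (z a - t a))

end TorusLineBundle

/-- The weight `exp(-(π/2) ∑ W_ab c_a c_b)`, where `Y = -Im Z`, `W = Y⁻¹` and
`c_a = z_a - z̄_a + i Y_aa - t_a + t̄_a`. The sum is real, as every `c_a` is purely imaginary. -/
noncomputable def explicitWeight {n : ℕ} (Z : Matrix (Fin n) (Fin n) ℂ) (t : Fin n → ℂ)
    (z : Fin n → ℂ) : ℝ :=
  let Y : Matrix (Fin n) (Fin n) ℝ := Matrix.of fun a b => -(Z a b).im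
  let c : Fin n → ℂ := fun a =>
    z a - (starRingEnd ℂ) (z a) + Complex.I * (Y a a : ℂ) - t a + (starRingEnd ℂ) (t a)
  Real.exp (-(Real.pi / 2) * (∑ a, ∑ b, ((Y⁻¹ a b : ℝ) : ℂ) * c a * c b).re)

/-!
Everything follows from the fact that the curvature form `√-1 ∂∂̄ log h` is constant on `ℂⁿ`
(`leviMatrix_eq_of_pluriharmonic_log_det`). Put `φ = log h` and let `g` be its matrix of mixed
second derivatives. Ricci-flatness says that `log det g` is pluriharmonic, hence has the mean
value property over balls, and the automorphy of `h` says that `φ` changes by pluriharmonic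
functions under the lattice. So the difference of `φ` and its average over a large ball is
periodic and has a minimum, at which `g` dominates its own average. Strict concavity of `log det`
(`Matrix.PosDef.log_det_le`) turns this into an equality, and `g` is constant on the ball. This
replaces the solution of the Monge–Ampère equation by an elementary minimum principle.

A function with constant positive definite Levi form is `|Pz|² + Re G(z)` with `G` entire
(`exists_sum_norm_sq_add_re`). The substitution `(u, z) ↦ (u - iG(z), Pz)` therefore maps the
covering `{log h(z) < Im u}` onto the Siegel domain `{|z|² < Im u}`, with constant Jacobian, and
the Cayley transform identifies the latter with the ball.

The Bergman kernel is needed on the diagonal only. At the center of the ball it is constant by the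
mean value property; the transformation rule (`HasKernelDiag.pullback`) and an explicit
automorphism of the Siegel domain moving a given point to `(i, 0)` give
`K = c (Im u - log h(z))^{-(n+2)}` on the covering. Since
`log (|e^{iu/2}|² h(z)) = -(Im u - log h(z))`, the potential `log K` of the Bergman metric is, up
to a constant, the pull-back of `-(n+2) log |log r|`. Finally
`√-1 ∂∂̄ log r` is the pull-back of `√-1 ∂∂̄ log h`, because `log |w|²` is pluriharmonic, so the
summand `-log r` in the Calabi potential cancels the metric of the base.

For a bundle in normal form, `log h = (π/2) xᵀ Y⁻¹ x` where `x_a` is `2 Im z_a` plus a constant.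
Its Levi form is constant and positive definite, and its compatibility with the multipliers has to
be checked on the generators of the lattice only (`TorusLineBundle.invariant_of_span`).
-/

open Filter Topology InnerProductSpace Metric Laplacian MeasureTheory

/-! ### Calculus of Levi forms -/

section LeviCalculus

variable {E : Type*} [NormedAddCommGroup E] [NormedSpace ℂ E]
  {E' : Type*} [NormedAddCommGroup E'] [NormedSpace ℂ E']

theorem Filter.EventuallyEq.leviForm_eq {f g : E → ℝ} {p : E} (h : f =ᶠ[𝓝 p] g) (v w : E) :
    leviForm f p v w = leviForm g p v w := by
  have h1 : (fun x => (f x : ℂ)) =ᶠ[𝓝 p] fun x => (g x : ℂ) := h.fun_comp Complex.ofReal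
  have h2 : (fun q => delbarD (fun x => (f x : ℂ)) w q) =ᶠ[𝓝 p]
      fun q => delbarD (fun x => (g x : ℂ)) w q := by
    filter_upwards [h1.fderiv (𝕜 := ℝ)] with q hq
    simp only [delbarD, hq]
  simp only [leviForm, delD, h2.fderiv_eq]

/-- The Levi form in terms of the second real derivative. -/
theorem leviForm_eq {f : E → ℝ} {p : E} (hf : ContDiffAt ℝ 2 f p) (v w : E) :
    leviForm f p v w = (1 / 4 : ℂ) *
      ((fderiv ℝ (fderiv ℝ f) p v w + fderiv ℝ (fderiv ℝ f) p (Complex.I • v) (Complex.I • w) : ℝ)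
        + Complex.I * (fderiv ℝ (fderiv ℝ f) p v (Complex.I • w)
          - fderiv ℝ (fderiv ℝ f) p (Complex.I • v) w : ℝ)) := by
  have hd : ∀ᶠ q in 𝓝 p, DifferentiableAt ℝ f q := by
    filter_upwards [hf.eventually (by simp)] with q hq using hq.differentiableAt (by simp)
  have h2 : (fun q => delbarD (fun x => (f x : ℂ)) w q) =ᶠ[𝓝 p] fun q =>
      (1 / 2 : ℂ) * ((fderiv ℝ f q w : ℂ) + Complex.I * (fderiv ℝ f q (Complex.I • w) : ℂ)) := by
    filter_upwards [hd] with q hq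
    have := (Complex.ofRealCLM.hasFDerivAt.comp q hq.hasFDerivAt).fderiv
    have h3 : fderiv ℝ (fun x => (f x : ℂ)) q = Complex.ofRealCLM.comp (fderiv ℝ f q) := this
    simp [delbarD, h3]
  have hff : HasFDerivAt (fderiv ℝ f) (fderiv ℝ (fderiv ℝ f) p) p :=
    ((hf.fderiv_right (m := 1) (by norm_num)).differentiableAt (by simp)).hasFDerivAt
  have hev : ∀ u : E, HasFDerivAt (fun q => (fderiv ℝ f q u : ℂ))
      (Complex.ofRealCLM.comp ((fderiv ℝ (fderiv ℝ f) p).flip u)) p := fun u =>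
    Complex.ofRealCLM.hasFDerivAt.comp p (hff.clm_apply (hasFDerivAt_const u p) |>.congr_fderiv
      (by ext; simp))
  have h4 :=
    (((hev w).add ((hev (Complex.I • w)).const_mul Complex.I)).const_mul (1 / 2 : ℂ)).fderiv
  have h5 : fderiv ℝ (fun q => delbarD (fun x => (f x : ℂ)) w q) p = _ :=
    h2.fderiv_eq.trans h4
  simp only [leviForm, delD, h5]
  simp
  linear_combination (1 / 4 * (fderiv ℝ (fderiv ℝ f) p (Complex.I • v) (Complex.I • w) : ℂ)) *
    (-1 : ℂ) * Complex.I_mul_I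

theorem leviForm_self {f : E → ℝ} {p : E} (hf : ContDiffAt ℝ 2 f p) (v : E) :
    leviForm f p v v = ((1 / 4 : ℝ) * (fderiv ℝ (fderiv ℝ f) p v v +
      fderiv ℝ (fderiv ℝ f) p (Complex.I • v) (Complex.I • v)) : ℝ) := by
  rw [leviForm_eq hf, hf.isSymmSndFDerivAt (by simp) v (Complex.I • v)]
  simp

theorem leviForm_conj {f : E → ℝ} {p : E} (hf : ContDiffAt ℝ 2 f p) (v w : E) :
    leviForm f p w v = (starRingEnd ℂ) (leviForm f p v w) := by
  have hs := hf.isSymmSndFDerivAt (by simp)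
  rw [leviForm_eq hf, leviForm_eq hf, hs w v, hs (Complex.I • w) v, hs w (Complex.I • v),
    hs (Complex.I • w) (Complex.I • v)]
  simp only [map_mul, map_add, Complex.conj_ofReal, Complex.conj_I, map_one, map_div₀, map_ofNat]
  push_cast
  ring

theorem leviForm_add_left {f : E → ℝ} {p : E} (hf : ContDiffAt ℝ 2 f p) (v v' w : E) :
    leviForm f p (v + v') w = leviForm f p v w + leviForm f p v' w := by
  simp only [leviForm_eq hf, smul_add, map_add, _root_.add_apply]
  push_cast
  ring

theorem leviForm_smul_left {f : E → ℝ} {p : E} (hf : ContDiffAt ℝ 2 f p) (c : ℂ) (v w : E) :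
    leviForm f p (c • v) w = c * leviForm f p v w := by
  have h1 : c • v = c.re • v + c.im • (Complex.I • v) := by
    conv_lhs => rw [← Complex.re_add_im c]
    rw [add_smul, mul_smul]
    simp [Complex.coe_smul]
  have h2 : Complex.I • c • v = c.re • (Complex.I • v) - c.im • v := by
    rw [h1, smul_add, smul_comm, smul_comm Complex.I c.im, smul_smul Complex.I Complex.I]
    simp [sub_eq_add_neg]
  rw [leviForm_eq hf, leviForm_eq hf, h2, h1]
  simp only [map_add, map_sub, map_smul, _root_.add_apply,
    _root_.sub_apply, _root_.smul_apply, smul_eq_mul]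
  push_cast
  conv_rhs => rw [← Complex.re_add_im c]
  linear_combination (-1 / 4 : ℂ) * (c.im : ℂ) * ((fderiv ℝ (fderiv ℝ f) p v (Complex.I • w) : ℂ)
    - (fderiv ℝ (fderiv ℝ f) p (Complex.I • v) w : ℂ)) * Complex.I_mul_I

theorem leviForm_add_right {f : E → ℝ} {p : E} (hf : ContDiffAt ℝ 2 f p) (v w w' : E) :
    leviForm f p v (w + w') = leviForm f p v w + leviForm f p v w' := by
  rw [leviForm_conj hf, leviForm_add_left hf, map_add, ← leviForm_conj hf, ← leviForm_conj hf]

theorem leviForm_smul_right {f : E → ℝ} {p : E} (hf : ContDiffAt ℝ 2 f p) (c : ℂ) (v w : E) :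
    leviForm f p v (c • w) = (starRingEnd ℂ) c * leviForm f p v w := by
  rw [leviForm_conj hf, leviForm_smul_left hf, map_mul, ← leviForm_conj hf]

theorem leviForm_add {f g : E → ℝ} {p : E} (hf : ContDiffAt ℝ 2 f p) (hg : ContDiffAt ℝ 2 g p)
    (v w : E) :
    leviForm (fun x => f x + g x) p v w = leviForm f p v w + leviForm g p v w := by
  have h : fderiv ℝ (fun x => f x + g x) =ᶠ[𝓝 p] fun x => fderiv ℝ f x + fderiv ℝ g x := by
    filter_upwards [hf.eventually (by simp), hg.eventually (by simp)] with q h1 h2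
    exact fderiv_fun_add (h1.differentiableAt (by simp)) (h2.differentiableAt (by simp))
  have h' : fderiv ℝ (fderiv ℝ (fun x => f x + g x)) p =
      fderiv ℝ (fderiv ℝ f) p + fderiv ℝ (fderiv ℝ g) p := by
    rw [h.fderiv_eq]
    exact fderiv_fun_add ((hf.fderiv_right (m := 1) (by norm_num)).differentiableAt (by simp))
      ((hg.fderiv_right (m := 1) (by norm_num)).differentiableAt (by simp))
  rw [leviForm_eq (hf.add hg), leviForm_eq hf, leviForm_eq hg, h']
  simp only [_root_.add_apply]
  push_cast
  ring

theorem leviForm_const_mul {f : E → ℝ} {p : E} (hf : ContDiffAt ℝ 2 f p) (c : ℝ)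
    (v w : E) :
    leviForm (fun x => c * f x) p v w = c * leviForm f p v w := by
  have h : fderiv ℝ (fun x => c * f x) =ᶠ[𝓝 p] fun x => c • fderiv ℝ f x := by
    filter_upwards [hf.eventually (by simp)] with q h1
    exact fderiv_const_mul (h1.differentiableAt (by simp)) c
  have h' : fderiv ℝ (fderiv ℝ (fun x => c * f x)) p = c • fderiv ℝ (fderiv ℝ f) p := by
    rw [h.fderiv_eq]
    exact fderiv_fun_const_smul
      ((hf.fderiv_right (m := 1) (by norm_num)).differentiableAt (by simp)) c
  rw [leviForm_eq (contDiffAt_const.mul hf), leviForm_eq hf, h']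
  simp only [_root_.smul_apply, smul_eq_mul]
  push_cast
  ring

theorem leviForm_sub {f g : E → ℝ} {p : E} (hf : ContDiffAt ℝ 2 f p) (hg : ContDiffAt ℝ 2 g p)
    (v w : E) :
    leviForm (fun x => f x - g x) p v w = leviForm f p v w - leviForm g p v w := by
  have h := leviForm_add hf (contDiffAt_const (c := (-1 : ℝ)) |>.mul hg) v w
  rw [leviForm_const_mul hg] at h
  simp only [neg_mul, one_mul, ← sub_eq_add_neg, Complex.ofReal_neg, Complex.ofReal_one] at h
  exact h

theorem leviForm_const (c : ℝ) (p v w : E) : leviForm (fun _ : E => c) p v w = 0 := by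
  rw [leviForm_eq contDiffAt_const]
  simp

/-- The Levi form pulls back under holomorphic maps. -/
theorem leviForm_comp {f : E' → ℝ} {F : E → E'} {p : E} (hf : ContDiffAt ℝ 2 f (F p))
    (hF : ContDiffAt ℂ 2 F p) (v w : E) :
    leviForm (fun x => f (F x)) p v w =
      leviForm f (F p) (fderiv ℂ F p v) (fderiv ℂ F p w) := by
  have hFr : ContDiffAt ℝ 2 F p := hF.restrict_scalars ℝ
  have hc : ContDiffAt ℝ 2 (fun x => f (F x)) p := hf.comp p hFr
  have hDF : HasFDerivAt (fderiv ℂ F) (fderiv ℂ (fderiv ℂ F) p) p :=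
    ((hF.fderiv_right (m := 1) (by norm_num)).differentiableAt (by simp)).hasFDerivAt
  have hDf : HasFDerivAt (fderiv ℝ f) (fderiv ℝ (fderiv ℝ f) (F p)) (F p) :=
    ((hf.fderiv_right (m := 1) (by norm_num)).differentiableAt (by simp)).hasFDerivAt
  have hF1 : HasFDerivAt F ((fderiv ℂ F p).restrictScalars ℝ) p :=
    (hF.differentiableAt (by simp)).hasFDerivAt.restrictScalars ℝ
  have hnear : ∀ w, (fun q => fderiv ℝ (fun x => f (F x)) q w) =ᶠ[𝓝 p]
      fun q => fderiv ℝ f (F q) (fderiv ℂ F q w) := by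
    intro w
    filter_upwards [hF.eventually (by simp), hFr.continuousAt.eventually (hf.eventually (by simp))]
      with q h1 h2
    have := ((h2.differentiableAt (by simp)).hasFDerivAt.comp q
      ((h1.differentiableAt (by simp)).hasFDerivAt.restrictScalars ℝ)).fderiv
    have h3 : fderiv ℝ (fun x => f (F x)) q = _ := this
    rw [h3]; rfl
  have key : ∀ v w, fderiv ℝ (fderiv ℝ (fun x => f (F x))) p v w =
      fderiv ℝ (fderiv ℝ f) (F p) (fderiv ℂ F p v) (fderiv ℂ F p w) +
        fderiv ℝ f (F p) (fderiv ℂ (fderiv ℂ F) p v w) := by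
    intro v w
    have e1 : HasFDerivAt (fun q => fderiv ℝ (fun x => f (F x)) q w)
        ((fderiv ℝ (fderiv ℝ (fun x => f (F x))) p).flip w) p :=
      (((hc.fderiv_right (m := 1) (by norm_num)).differentiableAt (by simp)).hasFDerivAt.clm_apply
        (hasFDerivAt_const w p)).congr_fderiv (by ext; simp)
    have e2 : HasFDerivAt (fun q => fderiv ℂ F q w)
        (((fderiv ℂ (fderiv ℂ F) p).flip w).restrictScalars ℝ) p :=
      ((hDF.clm_apply (hasFDerivAt_const w p)).congr_fderiv
        (g' := (fderiv ℂ (fderiv ℂ F) p).flip w) (by ext; simp)).restrictScalars ℝ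
    have e3 := (hDf.comp p hF1).clm_apply e2
    have e4 := e1.unique (e3.congr_of_eventuallyEq (hnear w))
    have := congrArg (fun T => T v) e4
    simpa [add_comm] using this
  rw [leviForm_eq hc, leviForm_eq hf]
  simp only [key, map_smul, _root_.smul_apply]
  simp only [smul_smul, Complex.I_mul_I, neg_smul, one_smul, map_neg]
  push_cast
  ring

end LeviCalculus

/-! ### Regularity of holomorphic maps of several variables -/

section Regularity

variable {E : Type*} [NormedAddCommGroup E] [NormedSpace ℂ E]
  {F : Type*} [NormedAddCommGroup F] [NormedSpace ℂ F]

/-- The Cauchy estimate for the derivative of a holomorphic map on a ball. -/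
theorem norm_fderiv_le_of_forall_mem_ball {f : E → F} {x : E} {ρ M : ℝ} (hρ : 0 < ρ)
    (hd : DifferentiableOn ℂ f (ball x ρ)) (hM : ∀ y ∈ ball x ρ, ‖f y‖ ≤ M) :
    ‖fderiv ℂ f x‖ ≤ 2 * M / ρ := by
  have hM0 : 0 ≤ M := (norm_nonneg _).trans (hM x (mem_ball_self hρ))
  refine ContinuousLinearMap.opNorm_le_bound _ (by positivity) fun v => ?_
  rcases eq_or_ne v 0 with rfl | hv
  · simp
  have hv' : 0 < ‖v‖ := norm_pos_iff.2 hv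
  -- the affine line in the direction `v`, on the disc of radius `ρ / (2‖v‖)`
  have hmem : ∀ ζ : ℂ, ‖ζ‖ ≤ ρ / (2 * ‖v‖) → x + ζ • v ∈ ball x ρ := by
    intro ζ hζ
    rw [mem_ball, dist_eq_norm, add_sub_cancel_left, norm_smul]
    calc ‖ζ‖ * ‖v‖ ≤ ρ / (2 * ‖v‖) * ‖v‖ := by gcongr
      _ = ρ / 2 := by field_simp
      _ < ρ := by linarith
  have hline : ∀ ζ : ℂ, HasDerivAt (fun ζ : ℂ => x + ζ • v) v ζ := fun ζ => by
    simpa using ((hasDerivAt_id ζ).smul_const v).const_add x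
  have hdiff : ∀ ζ : ℂ, ‖ζ‖ ≤ ρ / (2 * ‖v‖) →
      HasDerivAt (fun ζ : ℂ => f (x + ζ • v)) (fderiv ℂ f (x + ζ • v) v) ζ := fun ζ hζ =>
    ((hd.differentiableAt (isOpen_ball.mem_nhds (hmem ζ hζ))).hasFDerivAt.comp_hasDerivAt ζ
      (hline ζ))
  have hR : 0 < ρ / (2 * ‖v‖) := by positivity
  have hcl : DiffContOnCl ℂ (fun ζ : ℂ => f (x + ζ • v)) (ball 0 (ρ / (2 * ‖v‖))) := by
    apply DifferentiableOn.diffContOnCl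
    rw [closure_ball _ hR.ne']
    intro ζ hζ
    exact (hdiff ζ (by simpa using hζ)).differentiableAt.differentiableWithinAt
  have h := Complex.norm_deriv_le_of_forall_mem_sphere_norm_le hR hcl
    (C := M) fun ζ hζ => hM _ (hmem ζ (by simpa using (mem_sphere_iff_norm.1 hζ).le))
  rw [(hdiff 0 (by simpa using hR.le)).deriv] at h
  simp only [zero_smul, add_zero] at h
  calc _ ≤ _ := h
    _ = 2 * M / ρ * ‖v‖ := by field_simp

variable [FiniteDimensional ℂ E] [FiniteDimensional ℂ F]

/-- The directional derivatives of a holomorphic map are holomorphic: they are given by Cauchy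
integrals, which can be differentiated under the integral sign. -/
theorem differentiableOn_fderiv_apply {f : E → F} {U : Set E} (hU : IsOpen U)
    (hf : DifferentiableOn ℂ f U) (v : E) :
    DifferentiableOn ℂ (fun x => fderiv ℂ f x v) U := by
  intro x₀ hx₀
  have : CompleteSpace F := FiniteDimensional.complete ℂ F
  have : SecondCountableTopology F := by
    have := FiniteDimensional.proper ℂ F
    infer_instance
  let _ : MeasurableSpace E := borel E
  have : BorelSpace E := ⟨rfl⟩
  obtain ⟨ε, hε, hεU⟩ := Metric.isOpen_iff.1 hU x₀ hx₀
  -- a ball around `x₀` on which `f` is bounded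
  obtain ⟨δ, hδ, hδb⟩ := Metric.continuousAt_iff.1
    (hf.differentiableAt (hU.mem_nhds hx₀)).continuousAt 1 one_pos
  obtain ⟨ρ, hρ, hρε, hρδ⟩ : ∃ ρ > 0, 4 * ρ ≤ ε ∧ 4 * ρ ≤ δ :=
    ⟨min ε δ / 4, by positivity, by linarith [min_le_left ε δ], by linarith [min_le_right ε δ]⟩
  set M := ‖f x₀‖ + 1
  have hM : ∀ y ∈ ball x₀ (4 * ρ), ‖f y‖ ≤ M := by
    intro y hy
    have h1 := hδb (lt_of_lt_of_le (mem_ball.1 hy) hρδ)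
    rw [dist_eq_norm] at h1
    have := norm_le_norm_add_norm_sub' (f y) (f x₀)
    linarith
  have hsub : ball x₀ (4 * ρ) ⊆ U := (ball_subset_ball hρε).trans hεU
  have hdiffat : ∀ y ∈ ball x₀ (4 * ρ), DifferentiableAt ℂ f y := fun y hy =>
    hf.differentiableAt (hU.mem_nhds (hsub hy))
  have hbound : ∀ y ∈ ball x₀ (3 * ρ), ‖fderiv ℂ f y‖ ≤ 2 * M / ρ := by
    intro y hy
    have hs : ball y ρ ⊆ ball x₀ (4 * ρ) := ball_subset_ball' (by
      have := mem_ball.1 hy; linarith)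
    exact norm_fderiv_le_of_forall_mem_ball hρ
      (fun z hz => (hdiffat z (hs hz)).differentiableWithinAt)
      fun z hz => hM z (hs hz)
  obtain ⟨r, hr, hrv⟩ : ∃ r > 0, r * ‖v‖ ≤ ρ :=
    ⟨ρ / (‖v‖ + 1), by positivity, by
      rw [div_mul_eq_mul_div, div_le_iff₀ (by positivity)]; nlinarith [norm_nonneg v]⟩
  have hmem : ∀ x ∈ ball x₀ ρ, ∀ ζ : ℂ, ‖ζ‖ ≤ r → x + ζ • v ∈ ball x₀ (3 * ρ) := by
    intro x hx ζ hζ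
    rw [mem_ball, dist_eq_norm] at *
    calc ‖x + ζ • v - x₀‖ = ‖(x - x₀) + ζ • v‖ := by congr 1; abel
      _ ≤ ‖x - x₀‖ + ‖ζ‖ * ‖v‖ := (norm_add_le _ _).trans (by rw [norm_smul])
      _ ≤ ‖x - x₀‖ + r * ‖v‖ := by gcongr
      _ < 3 * ρ := by linarith
  have h34 : ball x₀ (3 * ρ) ⊆ ball x₀ (4 * ρ) := ball_subset_ball (by linarith)
  have hline : ∀ (x : E) (ζ : ℂ), HasDerivAt (fun ζ : ℂ => x + ζ • v) v ζ := fun x ζ => by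
    simpa using ((hasDerivAt_id ζ).smul_const v).const_add x
  have hder : ∀ x ∈ ball x₀ ρ, ∀ ζ : ℂ, ‖ζ‖ ≤ r →
      HasDerivAt (fun ζ : ℂ => f (x + ζ • v)) (fderiv ℂ f (x + ζ • v) v) ζ := fun x hx ζ hζ =>
    (hdiffat _ (h34 (hmem x hx ζ hζ))).hasFDerivAt.comp_hasDerivAt ζ (hline x ζ)
  -- Cauchy's formula on the disc of radius `r` in the direction `v`
  have hcauchy : ∀ x ∈ ball x₀ ρ, fderiv ℂ f x v =
      (2 * Real.pi * Complex.I : ℂ)⁻¹ • ∮ ζ in C(0, r), (ζ - 0)⁻¹ ^ 2 • f (x + ζ • v) := by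
    intro x hx
    have hcl : DiffContOnCl ℂ (fun ζ : ℂ => f (x + ζ • v)) (ball 0 r) := by
      apply DifferentiableOn.diffContOnCl
      rw [closure_ball _ hr.ne']
      intro ζ hζ
      exact (hder x hx ζ (by simpa using hζ)).differentiableAt.differentiableWithinAt
    have h0 := hder x hx 0 (by simpa using hr.le)
    simp only [zero_smul, add_zero] at h0
    have h2 := hcl.deriv_eq_smul_circleIntegral hr
    simp only [one_div, ← inv_pow] at h2
    rw [← h0.deriv, h2, inv_smul_smul₀ (by simp [Real.pi_ne_zero])]
  have hcm : ∀ θ : ℝ, ‖circleMap 0 r θ‖ ≤ r := fun θ => by simp [abs_of_pos hr]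
  have hcm0 : ∀ θ : ℝ, circleMap 0 r θ ≠ 0 := fun θ => circleMap_ne_center hr.ne'
  set k : ℝ → ℂ := fun θ => deriv (circleMap 0 r) θ * (circleMap 0 r θ - 0)⁻¹ ^ 2 with hk
  have hkc : Continuous k := by
    simp only [hk, deriv_circleMap, sub_zero]
    exact ((continuous_circleMap 0 r).mul continuous_const).mul
      (((continuous_circleMap 0 r).inv₀ hcm0).pow 2)
  have hkb : ∀ θ, ‖k θ‖ ≤ r⁻¹ := fun θ => by
    simp only [hk, deriv_circleMap, norm_mul, norm_pow, norm_inv, sub_zero, norm_circleMap_zero,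
      Complex.norm_I, abs_of_pos hr]
    apply le_of_eq; field_simp
  have hfc : ∀ x ∈ ball x₀ ρ, Continuous fun θ : ℝ => f (x + circleMap 0 r θ • v) := by
    intro x hx
    rw [continuous_iff_continuousAt]
    intro θ
    have h1 : ContinuousAt (fun θ : ℝ => x + circleMap 0 r θ • v) θ := by fun_prop
    exact ContinuousAt.comp (f := fun θ : ℝ => x + circleMap 0 r θ • v)
      (hdiffat _ (h34 (hmem x hx _ (hcm θ)))).continuousAt h1
  have hint : HasFDerivAt (fun x => ∫ θ in (0 : ℝ)..2 * Real.pi,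
      k θ • f (x + circleMap 0 r θ • v))
      (∫ θ in (0 : ℝ)..2 * Real.pi, k θ • fderiv ℂ f (x₀ + circleMap 0 r θ • v)) x₀ := by
    refine intervalIntegral.hasFDerivAt_integral_of_dominated_of_fderiv_le
      (F := fun x θ => k θ • f (x + circleMap 0 r θ • v))
      (F' := fun x θ => k θ • fderiv ℂ f (x + circleMap 0 r θ • v))
      (bound := fun _ => r⁻¹ * (2 * M / ρ))
      (ball_mem_nhds x₀ hρ) ?_ ?_ ?_ ?_ ?_ ?_
    · filter_upwards [ball_mem_nhds x₀ hρ] with x hx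
      exact (hkc.smul (hfc x hx)).aestronglyMeasurable
    · exact (hkc.smul (hfc x₀ (mem_ball_self hρ))).intervalIntegrable _ _
    · have := FiniteDimensional.proper ℂ F
      have h1 : Measurable (fderiv ℂ f) := measurable_fderiv ℂ f
      have h2 : Measurable fun θ : ℝ => x₀ + circleMap 0 r θ • v := by
        apply Continuous.measurable; fun_prop
      exact (hkc.aestronglyMeasurable).smul (h1.comp h2).aestronglyMeasurable
    · refine Eventually.of_forall fun θ _ x hx => ?_
      rw [norm_smul]
      exact mul_le_mul (hkb θ) (hbound _ (hmem x hx _ (hcm θ))) (norm_nonneg _) (by positivity)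
    · exact continuous_const.intervalIntegrable _ _
    · refine Eventually.of_forall fun θ _ x hx => ?_
      have h1 := (hdiffat _ (h34 (hmem x hx _ (hcm θ)))).hasFDerivAt
      have h2 : HasFDerivAt (fun x : E => x + circleMap 0 r θ • v) (ContinuousLinearMap.id ℂ E) x :=
        (hasFDerivAt_id x).add_const _
      exact (h1.comp x h2).const_smul (k θ)
  have heq : (fun x => fderiv ℂ f x v) =ᶠ[𝓝 x₀] fun x => (2 * Real.pi * Complex.I : ℂ)⁻¹ •
      ∫ θ in (0 : ℝ)..2 * Real.pi, k θ • f (x + circleMap 0 r θ • v) := by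
    filter_upwards [ball_mem_nhds x₀ hρ] with x hx
    rw [hcauchy x hx, circleIntegral]
    simp only [hk, smul_smul]
  exact ((hint.differentiableAt.const_smul _).congr_of_eventuallyEq heq).differentiableWithinAt

/-- A holomorphic map of several variables is smooth. -/
theorem contDiffOn_nat_of_differentiableOn {U : Set E} (hU : IsOpen U) (k : ℕ) :
    ∀ {f : E → F}, DifferentiableOn ℂ f U → ContDiffOn ℂ k f U := by
  induction k with
  | zero => exact fun hf => contDiffOn_zero.2 hf.continuousOn
  | succ k ih =>
    intro f hf
    push_cast
    rw [contDiffOn_succ_iff_fderiv_of_isOpen hU]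
    exact ⟨hf, by simp, contDiffOn_clm_apply.2 fun v => ih (differentiableOn_fderiv_apply hU hf v)⟩

theorem contDiffAt_two_of_differentiableOn {f : E → F} {U : Set E} (hf : DifferentiableOn ℂ f U)
    (hU : IsOpen U) {x : E} (hx : x ∈ U) : ContDiffAt ℂ 2 f x :=
  (contDiffOn_nat_of_differentiableOn hU 2 hf).contDiffAt (hU.mem_nhds hx)

end Regularity

/-! ### Pluriharmonic functions -/

section Pluriharmonic

variable {E : Type*} [NormedAddCommGroup E] [NormedSpace ℂ E]

theorem laplacian_eq_leviForm {f : ℂ → ℝ} {z : ℂ} (hf : ContDiffAt ℝ 2 f z) :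
    ((Δ f z : ℝ) : ℂ) = 4 * leviForm f z 1 1 := by
  rw [laplacian_eq_iteratedFDeriv_complexPlane, leviForm_self hf]
  simp only [iteratedFDeriv_two_apply]
  simp

/-- The mean value property of pluriharmonic functions, on circles in complex lines. -/
theorem circleAverage_line_eq {u : E → ℝ} (hu : ContDiff ℝ 2 u)
    (h0 : ∀ p v, leviForm u p v v = 0) (z v : E) :
    Real.circleAverage (fun ζ : ℂ => u (z + ζ • v)) 0 1 = u z := by
  have hl : ContDiff ℂ 2 fun ζ : ℂ => z + ζ • v := by fun_prop
  have hc : ContDiff ℝ 2 fun ζ : ℂ => u (z + ζ • v) := hu.comp (hl.restrict_scalars ℝ)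
  have hh : HarmonicOnNhd (fun ζ : ℂ => u (z + ζ • v)) (closedBall 0 |1|) := by
    intro ζ _
    refine ⟨hc.contDiffAt, Eventually.of_forall fun ξ => ?_⟩
    have h := laplacian_eq_leviForm (hc.contDiffAt (x := ξ))
    rw [leviForm_comp (F := fun ζ : ℂ => z + ζ • v) hu.contDiffAt hl.contDiffAt, h0] at h
    simpa using h
  simpa using hh.circleAverage_eq

theorem leviForm_log_norm_complex {z : ℂ} (hz : z ≠ 0) (v w : ℂ) :
    leviForm (fun x : ℂ => Real.log ‖x‖) z v w = 0 := by
  have hh : HarmonicAt (fun x : ℂ => Real.log ‖x‖) z :=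
    AnalyticAt.harmonicAt_log_norm (f := fun x => x) analyticAt_id hz
  have h := laplacian_eq_leviForm hh.1
  rw [hh.2.eq_of_nhds] at h
  have h1 : leviForm (fun x : ℂ => Real.log ‖x‖) z 1 1 = 0 := by simpa using h.symm
  have hv : v = v • (1 : ℂ) := by simp
  have hw : w = w • (1 : ℂ) := by simp
  rw [hv, hw, leviForm_smul_left hh.1, leviForm_smul_right hh.1, h1]
  simp

/-- The logarithm of the modulus of a zero-free holomorphic function is pluriharmonic. -/
theorem leviForm_log_norm {J : E → ℂ} {p : E} (hJ : ContDiffAt ℂ 2 J p) (h0 : J p ≠ 0) (v w : E) :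
    leviForm (fun x => Real.log ‖J x‖) p v w = 0 := by
  have hh : HarmonicAt (fun x : ℂ => Real.log ‖x‖) (J p) :=
    AnalyticAt.harmonicAt_log_norm (f := fun x => x) analyticAt_id h0
  rw [leviForm_comp (f := fun x : ℂ => Real.log ‖x‖) hh.1 hJ, leviForm_log_norm_complex h0]

theorem contDiffAt_log_norm {J : E → ℂ} {p : E} (hJ : ContDiffAt ℂ 2 J p) (h0 : J p ≠ 0) :
    ContDiffAt ℝ 2 (fun x => Real.log ‖J x‖) p :=
  ((hJ.restrict_scalars ℝ).norm ℝ h0).log (norm_ne_zero_iff.2 h0)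

end Pluriharmonic

/-! ### Concavity of the logarithm of the determinant -/

section LogDet

open Matrix
open scoped MatrixOrder ComplexOrder

variable {m : Type*} [Fintype m] [DecidableEq m]

theorem Matrix.PosSemidef.exists_eq_conjTranspose_mul_self {𝕜 : Type*} [RCLike 𝕜]
    {A : Matrix m m 𝕜} (hA : A.PosSemidef) : ∃ B : Matrix m m 𝕜, A = Bᴴ * B :=
  CStarAlgebra.nonneg_iff_eq_star_mul_self.mp hA.nonneg

/-- The trace of a product of two positive semidefinite matrices is nonnegative. -/
theorem Matrix.PosSemidef.re_trace_mul_nonneg {A B : Matrix m m ℂ} (hA : A.PosSemidef)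
    (hB : B.PosSemidef) : 0 ≤ (A * B).trace.re := by
  obtain ⟨C, rfl⟩ := hA.exists_eq_conjTranspose_mul_self
  rw [Matrix.mul_assoc, trace_mul_comm]
  have h := (hB.mul_mul_conjTranspose_same C).trace_nonneg
  exact (Complex.le_def.1 h).1

/-- The graph of `log det` lies below its tangent plane at the identity, and touches it only
there. -/
theorem Matrix.PosDef.log_det_le_trace_sub_card {A : Matrix m m ℂ} (hA : A.PosDef) :
    Real.log A.det.re ≤ A.trace.re - Fintype.card m ∧
      (Real.log A.det.re = A.trace.re - Fintype.card m → A = 1) := by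
  have hdet : A.det.re = ∏ i, hA.1.eigenvalues i := by
    rw [hA.1.det_eq_prod_eigenvalues, ← Complex.ofReal_re (∏ i, hA.1.eigenvalues i)]
    push_cast; rfl
  have htr : A.trace.re = ∑ i, hA.1.eigenvalues i := by
    rw [hA.1.trace_eq_sum_eigenvalues, ← Complex.ofReal_re (∑ i, hA.1.eigenvalues i)]
    push_cast; rfl
  have hpos := hA.eigenvalues_pos
  rw [hdet, htr, Real.log_prod fun i _ => (hpos i).ne']
  have hcard : (∑ i, hA.1.eigenvalues i) - Fintype.card m = ∑ i, (hA.1.eigenvalues i - 1) := by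
    simp
  rw [hcard]
  have hle : ∀ i ∈ Finset.univ, Real.log (hA.1.eigenvalues i) ≤ hA.1.eigenvalues i - 1 :=
    fun i _ => Real.log_le_sub_one_of_pos (hpos i)
  refine ⟨Finset.sum_le_sum hle, fun h => ?_⟩
  have h1 : ∀ i, hA.1.eigenvalues i = 1 := fun i => by
    have h2 := (Finset.sum_eq_sum_iff_of_le hle).1 h i (Finset.mem_univ i)
    by_contra h3
    exact (Real.log_lt_sub_one_of_pos (hpos i) h3).ne h2
  have h2 : (RCLike.ofReal ∘ hA.1.eigenvalues : m → ℂ) = fun _ => 1 := by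
    ext i; simp [h1 i]
  rw [hA.1.spectral_theorem, h2]
  simp

/-- The graph of `log det` lies below its tangent plane at `X`, and touches it only there. -/
theorem Matrix.PosDef.log_det_le {X Y : Matrix m m ℂ} (hX : X.PosDef) (hY : Y.PosDef) :
    Real.log Y.det.re ≤ Real.log X.det.re + ((X⁻¹ * Y).trace.re - Fintype.card m) ∧
      (Real.log Y.det.re = Real.log X.det.re + ((X⁻¹ * Y).trace.re - Fintype.card m) → Y = X) := by
  obtain ⟨Q, hQ⟩ := hX.inv.posSemidef.exists_eq_conjTranspose_mul_self
  have hXu : IsUnit X.det := (Matrix.isUnit_iff_isUnit_det X).1 hX.isUnit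
  have hXdet : X.det * (Q.det * (starRingEnd ℂ) Q.det) = 1 := by
    rw [starRingEnd_apply, mul_comm Q.det, ← det_conjTranspose Q, ← det_mul, ← hQ, ← det_mul,
      Matrix.mul_nonsing_inv X hXu, det_one]
  have hQ0 : Q.det ≠ 0 := by rintro h; simp [h] at hXdet
  have hQu : IsUnit Q := (Matrix.isUnit_iff_isUnit_det Q).2 (isUnit_iff_ne_zero.2 hQ0)
  have hM : (Q * Y * Qᴴ).PosDef :=
    hY.mul_mul_conjTranspose_same (Matrix.vecMul_injective_of_isUnit hQu)
  -- the congruence by `Q`, where `X⁻¹ = Qᴴ Q`, moves the base point `X` to the identity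
  have htr : (Q * Y * Qᴴ).trace = (X⁻¹ * Y).trace := by
    rw [Matrix.trace_mul_comm, ← Matrix.mul_assoc, ← hQ]
  have hXp := Complex.pos_iff.1 hX.det_pos
  have hYp := Complex.pos_iff.1 hY.det_pos
  have hXr : X.det = (X.det.re : ℂ) := Complex.ext rfl (by simpa using hXp.2.symm)
  have hYr : Y.det = (Y.det.re : ℂ) := Complex.ext rfl (by simpa using hYp.2.symm)
  have hdet : Real.log (Q * Y * Qᴴ).det.re = Real.log Y.det.re - Real.log X.det.re := by
    rw [← Real.log_div hYp.1.ne' hXp.1.ne']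
    congr 1
    have h1 : (Q * Y * Qᴴ).det = Y.det / X.det := by
      rw [det_mul, det_mul, det_conjTranspose, ← starRingEnd_apply, eq_div_iff hXu.ne_zero]
      linear_combination Y.det * hXdet
    rw [h1, hXr, hYr, ← Complex.ofReal_div]
    simp
  have h := hM.log_det_le_trace_sub_card
  rw [htr, hdet] at h
  refine ⟨by linarith [h.1], fun he => ?_⟩
  have h1 := h.2 (by linarith)
  -- `Q Y Qᴴ = 1` forces `Y⁻¹ = Qᴴ Q = X⁻¹`
  have h2 : Y * (Qᴴ * Q) = 1 := by
    have h3 : Q * (Y * Qᴴ) = 1 := by rw [← Matrix.mul_assoc, h1]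
    have h4 := mul_eq_one_comm.1 h3
    rwa [Matrix.mul_assoc] at h4
  rw [← hQ] at h2
  calc Y = Y * (X⁻¹ * X) := by rw [Matrix.nonsing_inv_mul X hXu, Matrix.mul_one]
    _ = X := by rw [← Matrix.mul_assoc, h2, Matrix.one_mul]

end LogDet

/-! ### Averages over circle-invariant measures -/

section CircleInvariant

variable {E : Type*} [NormedAddCommGroup E] [NormedSpace ℂ E] [MeasurableSpace E] [BorelSpace E]
  {F : Type*} [NormedAddCommGroup F] [NormedSpace ℝ F] [CompleteSpace F]

/-- For a measure that is invariant under multiplication by complex numbers of modulus `1`, a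
function may be replaced by its circle averages. -/
theorem integral_circleAverage_smul {ν : Measure E} [SFinite ν]
    (hν : ∀ c : ℂ, ‖c‖ = 1 → MeasurePreserving (fun x : E => c • x) ν ν) {f : E → F}
    (hf : Integrable f ν) :
    ∫ x, Real.circleAverage (fun ζ : ℂ => f (ζ • x)) 0 1 ∂ν = ∫ x, f x ∂ν := by
  have hc : ∀ θ : ℝ, ‖circleMap 0 1 θ‖ = 1 := fun θ => by simp
  set τ : Measure ℝ := volume.restrict (Set.Ioc 0 (2 * Real.pi)) with hτ
  have hmp : MeasurePreserving (fun q : ℝ × E => (q.1, circleMap 0 1 q.1 • q.2))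
      (τ.prod ν) (τ.prod ν) := by
    refine (MeasurePreserving.id τ).skew_product (g := fun θ x => circleMap 0 1 θ • x) ?_ ?_
    · apply Continuous.measurable
      simp only [Function.uncurry_def]
      exact ((continuous_circleMap 0 1).comp continuous_fst).smul continuous_snd
    · exact Eventually.of_forall fun θ => (hν _ (hc θ)).map_eq
  have hint : Integrable (fun q : ℝ × E => f (circleMap 0 1 q.1 • q.2)) (τ.prod ν) :=
    hmp.integrable_comp_of_integrable (hf.comp_snd τ)
  have hpi : (0 : ℝ) ≤ 2 * Real.pi := by positivity
  have h1 : ∀ θ : ℝ, ∫ x, f (circleMap 0 1 θ • x) ∂ν = ∫ x, f x ∂ν := fun θ => by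
    have hmeas := hν _ (hc θ)
    have hemb : MeasurableEmbedding fun x : E => circleMap 0 1 θ • x :=
      (Homeomorph.smulOfNeZero (circleMap 0 1 θ)
        (circleMap_ne_center one_ne_zero)).measurableEmbedding
    exact hmeas.integral_comp hemb f
  simp only [Real.circleAverage_def, intervalIntegral.integral_of_le hpi]
  rw [integral_smul, ← hτ, ← integral_integral_swap (f := fun θ x => f (circleMap 0 1 θ • x)) hint]
  simp only [h1, integral_const, hτ]
  rw [smul_smul, measureReal_restrict_apply_univ, Real.volume_real_Ioc_of_le hpi, sub_zero,
    inv_mul_cancel₀ (by positivity), one_smul]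

theorem integral_eq_of_circleAverage_eq {ν : Measure E} [SFinite ν]
    (hν : ∀ c : ℂ, ‖c‖ = 1 → MeasurePreserving (fun x : E => c • x) ν ν) {f : E → F}
    (hf : Integrable f ν) {a : F}
    (ha : ∀ᵐ x ∂ν, Real.circleAverage (fun ζ : ℂ => f (ζ • x)) 0 1 = a) :
    ∫ x, f x ∂ν = ν.real Set.univ • a := by
  rw [← integral_circleAverage_smul hν hf, integral_congr_ae ha, integral_const]

end CircleInvariant

theorem measurePreserving_smul_complex {c : ℂ} (hc : ‖c‖ = 1) :
    MeasurePreserving (fun x : ℂ => c * x) :=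
  (rotation ⟨c, mem_sphere_zero_iff_norm.2 hc⟩).measurePreserving

theorem measurePreserving_smul_pi {n : ℕ} {c : ℂ} (hc : ‖c‖ = 1) :
    MeasurePreserving (fun x : Fin n → ℂ => c • x) :=
  volume_preserving_pi fun _ => measurePreserving_smul_complex hc

theorem measurePreserving_smul_prod {n : ℕ} {c : ℂ} (hc : ‖c‖ = 1) :
    MeasurePreserving (fun x : CSpace n => c • x) :=
  (measurePreserving_smul_complex hc).prod (measurePreserving_smul_pi hc)

/-! ### Second derivatives of translation averages and at minima -/

section Average

variable {E : Type*} [NormedAddCommGroup E] [ProperSpace E] [MeasurableSpace E]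
  [BorelSpace E] {F : Type*} [NormedAddCommGroup F]
  {ν : Measure E} [IsFiniteMeasure ν] {R : ℝ}

theorem Continuous.integrable_of_ae_norm_le {f : E → F} (hf : Continuous f)
    (hR : ∀ᵐ y ∂ν, ‖y‖ ≤ R) : Integrable f ν := by
  obtain ⟨C, hC⟩ := (isCompact_closedBall (0 : E) R).exists_bound_of_continuousOn hf.continuousOn
  exact Integrable.of_bound hf.aestronglyMeasurable C
    (hR.mono fun y hy => hC y (by simpa using hy))

variable [NormedSpace ℝ E] [NormedSpace ℝ F]

theorem ContDiff.integrable_comp_add {f : E → F} {k : WithTop ℕ∞} (hf : ContDiff ℝ k f)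
    (hR : ∀ᵐ y ∂ν, ‖y‖ ≤ R) (z : E) : Integrable (fun y => f (z + y)) ν :=
  (hf.continuous.comp (continuous_const.add continuous_id)).integrable_of_ae_norm_le hR

theorem hasFDerivAt_integral_add {f : E → F} (hf : ContDiff ℝ 1 f) (hR : ∀ᵐ y ∂ν, ‖y‖ ≤ R)
    (z : E) :
    HasFDerivAt (fun z => ∫ y, f (z + y) ∂ν) (∫ y, fderiv ℝ f (z + y) ∂ν) z := by
  have hf' : Continuous (fderiv ℝ f) := hf.continuous_fderiv (by simp)
  obtain ⟨C, hC⟩ := (isCompact_closedBall z (1 + R)).exists_bound_of_continuousOn hf'.continuousOn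
  refine hasFDerivAt_integral_of_dominated_of_fderiv_le (F := fun z y => f (z + y))
    (F' := fun z y => fderiv ℝ f (z + y)) (bound := fun _ => C) (ball_mem_nhds z one_pos)
    ?_ ?_ ?_ ?_ ?_ ?_
  · exact Eventually.of_forall fun x =>
      (hf.continuous.comp (continuous_const.add continuous_id)).aestronglyMeasurable
  · exact (hf.continuous.comp (continuous_const.add continuous_id)).integrable_of_ae_norm_le hR
  · exact (hf'.comp (continuous_const.add continuous_id)).aestronglyMeasurable
  · filter_upwards [hR] with y hy x hx
    apply hC
    rw [mem_ball, dist_eq_norm] at hx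
    rw [mem_closedBall, dist_eq_norm]
    calc ‖x + y - z‖ = ‖(x - z) + y‖ := by congr 1; abel
      _ ≤ 1 + R := (norm_add_le _ _).trans (add_le_add hx.le hy)
  · exact integrable_const C
  · refine Eventually.of_forall fun y x _ => ?_
    have h1 : HasFDerivAt (fun x : E => x + y) (ContinuousLinearMap.id ℝ E) x :=
      (hasFDerivAt_id x).add_const _
    exact ((hf.differentiable (by simp) (x + y)).hasFDerivAt.comp x h1)

theorem contDiff_two_integral_add {f : E → F} (hf : ContDiff ℝ 3 f) (hR : ∀ᵐ y ∂ν, ‖y‖ ≤ R) :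
    ContDiff ℝ 2 (fun z => ∫ y, f (z + y) ∂ν) := by
  have h1 : ContDiff ℝ 2 (fderiv ℝ f) := hf.fderiv_right (by norm_num)
  have h2 : ContDiff ℝ 1 (fderiv ℝ (fderiv ℝ f)) := h1.fderiv_right (by norm_num)
  have d1 := hasFDerivAt_integral_add (hf.of_le (by norm_num)) hR
  have d2 := hasFDerivAt_integral_add (h1.of_le (by norm_num)) hR
  have d3 := hasFDerivAt_integral_add h2 hR
  have e1 : fderiv ℝ (fun z => ∫ y, f (z + y) ∂ν) = fun z => ∫ y, fderiv ℝ f (z + y) ∂ν :=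
    funext fun z => (d1 z).fderiv
  have e2 : fderiv ℝ (fun z => ∫ y, fderiv ℝ f (z + y) ∂ν) =
      fun z => ∫ y, fderiv ℝ (fderiv ℝ f) (z + y) ∂ν := funext fun z => (d2 z).fderiv
  have c2 : ContDiff ℝ 1 (fun z => ∫ y, fderiv ℝ f (z + y) ∂ν) := by
    rw [contDiff_one_iff_fderiv, e2]
    exact ⟨fun z => (d2 z).differentiableAt,
      Differentiable.continuous (𝕜 := ℝ) fun z => (d3 z).differentiableAt⟩
  have h : ContDiff ℝ (1 + 1) (fun z => ∫ y, f (z + y) ∂ν) := by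
    rw [contDiff_succ_iff_fderiv, e1]
    exact ⟨fun z => (d1 z).differentiableAt, by simp, c2⟩
  exact h.of_le (by norm_num)

end Average

theorem leviForm_integral_add {E : Type*} [NormedAddCommGroup E] [NormedSpace ℂ E] [ProperSpace E]
    [MeasurableSpace E] [BorelSpace E] {ν : Measure E} [IsFiniteMeasure ν] {R : ℝ}
    {f : E → ℝ} (hf : ContDiff ℝ 3 f) (hR : ∀ᵐ y ∂ν, ‖y‖ ≤ R) (z v w : E) :
    leviForm (fun z => ∫ y, f (z + y) ∂ν) z v w = ∫ y, leviForm f (z + y) v w ∂ν := by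
  have h1 : ContDiff ℝ 2 (fderiv ℝ f) := hf.fderiv_right (by norm_num)
  have h2 : ContDiff ℝ 1 (fderiv ℝ (fderiv ℝ f)) := h1.fderiv_right (by norm_num)
  have d1 := hasFDerivAt_integral_add (hf.of_le (by norm_num)) hR
  have d2 := hasFDerivAt_integral_add (h1.of_le (by norm_num)) hR
  have e1 : fderiv ℝ (fun z => ∫ y, f (z + y) ∂ν) = fun z => ∫ y, fderiv ℝ f (z + y) ∂ν :=
    funext fun z => (d1 z).fderiv
  have hc : Continuous fun y => fderiv ℝ (fderiv ℝ f) (z + y) :=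
    h2.continuous.comp (continuous_const.add continuous_id)
  have hap : ∀ a b, fderiv ℝ (fderiv ℝ (fun z => ∫ y, f (z + y) ∂ν)) z a b =
      ∫ y, fderiv ℝ (fderiv ℝ f) (z + y) a b ∂ν := by
    intro a b
    have hi := h2.integrable_comp_add hR z
    have hi2 : Integrable (fun y => fderiv ℝ (fderiv ℝ f) (z + y) a) ν :=
      (hc.clm_apply continuous_const).integrable_of_ae_norm_le hR
    rw [e1, (d2 z).fderiv, ContinuousLinearMap.integral_apply hi,
      ContinuousLinearMap.integral_apply hi2]
  have hI : ∀ a b, Integrable (fun y => fderiv ℝ (fderiv ℝ f) (z + y) a b) ν := fun a b =>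
    ((hc.clm_apply continuous_const).clm_apply continuous_const).integrable_of_ae_norm_le hR
  rw [leviForm_eq (contDiff_two_integral_add hf hR).contDiffAt]
  have h3 : ∀ y, leviForm f (z + y) v w = _ := fun y =>
    leviForm_eq (hf.of_le (by norm_num)).contDiffAt v w
  simp only [h3, hap]
  rw [integral_const_mul, integral_add, integral_const_mul, integral_complex_ofReal,
    integral_complex_ofReal,
    integral_add (hI _ _) (hI _ _), integral_sub (hI _ _) (hI _ _)]
  · exact ((hI _ _).add (hI _ _)).ofReal
  · exact (((hI _ _).sub (hI _ _)).ofReal).const_mul _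

/-- The second derivative at a local minimum is nonnegative. -/
theorem IsLocalMin.fderiv_fderiv_nonneg {E : Type*} [NormedAddCommGroup E] [NormedSpace ℝ E]
    {f : E → ℝ} {z : E} (hmin : IsLocalMin f z) (hf : ContDiff ℝ 2 f) (v : E) :
    0 ≤ fderiv ℝ (fderiv ℝ f) z v v := by
  set s : ℝ → ℝ := fun t => f (z + t • v) with hs
  have hl : ∀ t : ℝ, HasDerivAt (fun t : ℝ => z + t • v) v t := fun t => by
    simpa using ((hasDerivAt_id t).smul_const v).const_add z
  have hd : ∀ t, HasDerivAt s (fderiv ℝ f (z + t • v) v) t := fun t =>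
    (hf.differentiable (by simp) _).hasFDerivAt.comp_hasDerivAt t (hl t)
  have hds : deriv s = fun t => fderiv ℝ f (z + t • v) v := funext fun t => (hd t).deriv
  have hdd : deriv (deriv s) 0 = fderiv ℝ (fderiv ℝ f) z v v := by
    have h1 : ContDiff ℝ 1 (fderiv ℝ f) := hf.fderiv_right (by norm_num)
    have h2 : HasFDerivAt (fun q => fderiv ℝ f q v) ((fderiv ℝ (fderiv ℝ f) z).flip v)
        (z + (0 : ℝ) • v) := by
      rw [zero_smul, add_zero]
      exact ((h1.differentiable (by simp) z).hasFDerivAt.clm_apply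
        (hasFDerivAt_const v z)).congr_fderiv (by ext; simp)
    rw [hds]
    exact (HasFDerivAt.comp_hasDerivAt (f := fun t : ℝ => z + t • v) 0 h2 (hl 0)).deriv
  have hmin' : IsLocalMin s 0 := by
    have hc : Tendsto (fun t : ℝ => z + t • v) (𝓝 0) (𝓝 z) := by
      have := (hl 0).continuousAt.tendsto
      simpa using this
    have := hc.eventually hmin
    simpa [IsLocalMin, IsMinFilter, hs] using this
  -- otherwise `0` would also be a local maximum of `s`, which would then be locally constant
  by_contra hneg
  rw [not_le, ← hdd] at hneg
  have hmax : IsLocalMax s 0 :=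
    isLocalMax_of_deriv_deriv_neg hneg hmin'.deriv_eq_zero (hd 0).continuousAt
  have hconst : s =ᶠ[𝓝 0] fun _ => s 0 := by
    filter_upwards [hmin', hmax] with t h1 h2 using le_antisymm h2 h1
  have h0 : deriv (deriv s) 0 = 0 := by
    rw [hconst.deriv.deriv_eq]; simp
  exact hneg.ne h0

/-! ### Rigidity of Ricci-flat metrics with a potential on a torus -/

section Rigidity

open scoped ComplexOrder

variable {n : ℕ}

/-- The coefficient matrix of the Levi form in the standard coordinates of `ℂⁿ`. -/
noncomputable def leviMatrix (f : (Fin n → ℂ) → ℝ) (z : Fin n → ℂ) : Matrix (Fin n) (Fin n) ℂ :=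
  Matrix.of fun j k => leviForm f z (Pi.single j 1) (Pi.single k 1)

theorem leviForm_eq_sum {f : (Fin n → ℂ) → ℝ} {z : Fin n → ℂ} (hf : ContDiffAt ℝ 2 f z)
    (v w : Fin n → ℂ) :
    leviForm f z v w = ∑ j, ∑ k, v j * (starRingEnd ℂ) (w k) * leviMatrix f z j k := by
  have hl : ∀ (s : Finset (Fin n)) (w : Fin n → ℂ),
      leviForm f z (∑ j ∈ s, v j • (Pi.single j 1 : Fin n → ℂ)) w =
        ∑ j ∈ s, v j * leviForm f z (Pi.single j 1) w := by
    intro s w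
    induction s using Finset.cons_induction with
    | empty => simpa using leviForm_smul_left hf 0 0 w
    | cons a s ha ih =>
      rw [Finset.sum_cons, Finset.sum_cons, leviForm_add_left hf, leviForm_smul_left hf, ih]
  have hr : ∀ (s : Finset (Fin n)) (v : Fin n → ℂ),
      leviForm f z v (∑ j ∈ s, w j • (Pi.single j 1 : Fin n → ℂ)) =
        ∑ j ∈ s, (starRingEnd ℂ) (w j) * leviForm f z v (Pi.single j 1) := by
    intro s v
    induction s using Finset.cons_induction with
    | empty => simpa using leviForm_smul_right hf 0 v 0
    | cons a s ha ih =>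
      rw [Finset.sum_cons, Finset.sum_cons, leviForm_add_right hf, leviForm_smul_right hf, ih]
  have hv : ∀ v : Fin n → ℂ, v = ∑ j, v j • (Pi.single j 1 : Fin n → ℂ) := fun v => by
    simpa using (pi_eq_sum_univ' v)
  rw [hv v, hl, hv w]
  simp only [hr, Finset.mul_sum]
  rw [← hv v, ← hv w]
  simp only [leviMatrix, Matrix.of_apply, mul_assoc]

theorem star_dotProduct_leviMatrix {f : (Fin n → ℂ) → ℝ} {z : Fin n → ℂ}
    (hf : ContDiffAt ℝ 2 f z) (x : Fin n → ℂ) :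
    star x ⬝ᵥ (leviMatrix f z).mulVec x = leviForm f z (star x) (star x) := by
  rw [leviForm_eq_sum hf]
  simp only [dotProduct, Matrix.mulVec, Finset.mul_sum]
  refine Finset.sum_congr rfl fun j _ => Finset.sum_congr rfl fun k _ => ?_
  simp
  ring

theorem leviMatrix_isHermitian {f : (Fin n → ℂ) → ℝ} {z : Fin n → ℂ} (hf : ContDiffAt ℝ 2 f z) :
    (leviMatrix f z).IsHermitian := by
  ext j k
  simp only [leviMatrix, Matrix.conjTranspose_apply, Matrix.of_apply]
  exact (leviForm_conj hf _ _).symm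

theorem leviForm_self_im {E : Type*} [NormedAddCommGroup E] [NormedSpace ℂ E] {f : E → ℝ} {z : E}
    (hf : ContDiffAt ℝ 2 f z) (v : E) : (leviForm f z v v).im = 0 := by
  rw [leviForm_self hf]; exact Complex.ofReal_im _

theorem leviMatrix_posDef {f : (Fin n → ℂ) → ℝ} {z : Fin n → ℂ} (hf : ContDiffAt ℝ 2 f z)
    (hpos : ∀ v, v ≠ 0 → 0 < (leviForm f z v v).re) : (leviMatrix f z).PosDef := by
  refine Matrix.PosDef.of_dotProduct_mulVec_pos (leviMatrix_isHermitian hf) fun x hx => ?_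
  rw [star_dotProduct_leviMatrix hf, Complex.pos_iff]
  exact ⟨hpos _ (star_ne_zero.2 hx), (leviForm_self_im hf _).symm⟩

theorem ContDiff.leviForm {E : Type*} [NormedAddCommGroup E] [NormedSpace ℂ E] {f : E → ℝ}
    (hf : ContDiff ℝ 4 f) (v w : E) : ContDiff ℝ 2 fun z => leviForm f z v w := by
  have h1 : ContDiff ℝ 3 (fderiv ℝ f) := hf.fderiv_right (by norm_num)
  have h2 : ContDiff ℝ 2 (fderiv ℝ (fderiv ℝ f)) := h1.fderiv_right (by norm_num)
  have h3 : ∀ a b, ContDiff ℝ 2 fun z => fderiv ℝ (fderiv ℝ f) z a b := fun a b =>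
    (h2.clm_apply contDiff_const).clm_apply contDiff_const
  have h4 : (fun z => _root_.leviForm f z v w) = _ :=
    funext fun z => leviForm_eq (hf.of_le (by norm_num)).contDiffAt v w
  rw [h4]
  exact contDiff_const.mul ((Complex.ofRealCLM.contDiff.comp ((h3 _ _).add (h3 _ _))).add
    (contDiff_const.mul (Complex.ofRealCLM.contDiff.comp ((h3 _ _).sub (h3 _ _)))))

theorem contDiff_log_det_leviMatrix {f : (Fin n → ℂ) → ℝ} (hf : ContDiff ℝ 4 f)
    (hpos : ∀ z, (leviMatrix f z).PosDef) :
    ContDiff ℝ 2 fun z => Real.log (leviMatrix f z).det.re := by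
  have h : ContDiff ℝ 2 fun z => (leviMatrix f z).det := by
    simp only [Matrix.det_apply]
    refine ContDiff.sum fun σ _ => ContDiff.const_smul _ ?_
    exact contDiff_prod fun i _ => hf.leviForm _ _
  exact (Complex.reCLM.contDiff.comp h).log fun z => (Complex.pos_iff.1 (hpos z).det_pos).1.ne'

/-- A continuous function that is invariant under a lattice attains its minimum, in a ball that
depends on the lattice only. -/
theorem exists_min_of_lattice_invariant {E : Type*} [NormedAddCommGroup E] [NormedSpace ℝ E]
    [FiniteDimensional ℝ E] (Γ : Submodule ℤ E) [DiscreteTopology Γ] [IsZLattice ℝ Γ] :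
    ∃ M : ℝ, ∀ ψ : E → ℝ, Continuous ψ → (∀ l ∈ Γ, ∀ z, ψ (z + l) = ψ z) →
      ∃ z₀, ‖z₀‖ ≤ M ∧ ∀ z, ψ z₀ ≤ ψ z := by
  have : ProperSpace E := FiniteDimensional.proper ℝ E
  have : Module.Finite ℤ Γ := ZLattice.module_finite ℝ Γ
  have : Module.Free ℤ Γ := ZLattice.module_free ℝ Γ
  set b := (Module.Free.chooseBasis ℤ Γ).ofZLatticeBasis ℝ Γ with hb
  obtain ⟨M, hM⟩ := (ZSpan.fundamentalDomain_isBounded b).exists_norm_le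
  refine ⟨M, fun ψ hψ hper => ?_⟩
  have hcover : ∀ z : E, ∃ l ∈ Γ, ‖z + l‖ ≤ M := fun z => by
    obtain ⟨l, hl, -⟩ := ZSpan.exist_unique_vadd_mem_fundamentalDomain b z
    refine ⟨l, ?_, ?_⟩
    · exact ((Module.Free.chooseBasis ℤ Γ).ofZLatticeBasis_span ℝ).le l.2
    · have := hM _ hl
      rwa [Submodule.vadd_def, vadd_eq_add, add_comm] at this
  obtain ⟨l, -, hl⟩ := hcover 0
  obtain ⟨z₀, hz₀, hmin⟩ := (isCompact_closedBall (0 : E) M).exists_isMinOn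
    ⟨0 + l, by simpa using hl⟩ hψ.continuousOn
  refine ⟨z₀, by simpa using hz₀, fun z => ?_⟩
  obtain ⟨l, hlΓ, hl⟩ := hcover z
  rw [← hper l hlΓ z]
  exact hmin (by simpa using hl)

/-- A function `φ` on `ℂⁿ` whose Levi form is positive definite with `log det` pluriharmonic, and
which changes by pluriharmonic functions under translations by a lattice, has constant Levi form.

Let `ν` be the uniform probability measure on a large ball. The difference `ψ` of `φ` and its
`ν`-average is periodic because pluriharmonic functions equal their `ν`-averages. At a minimum
`z₀` of `ψ` the Levi form `g` of `φ` therefore dominates its `ν`-average `a`, so that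
`log det a ≤ log det g(z₀)`, and `log det g(z₀)` is the `ν`-average of `log det g(z₀ + ·)`. By the
strict concavity of `log det` this forces `g = a` on the ball around `z₀`. -/
theorem leviMatrix_eq_of_pluriharmonic_log_det (Γ : Submodule ℤ (Fin n → ℂ)) [DiscreteTopology Γ]
    [IsZLattice ℝ Γ] {φ : (Fin n → ℂ) → ℝ} (hφ : ContDiff ℝ 4 φ)
    (hper : ∀ l ∈ Γ, ∀ z v, leviForm (fun z => φ (z + l) - φ z) z v v = 0)
    (hpos : ∀ z v, v ≠ 0 → 0 < (leviForm φ z v v).re)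
    (hdet : ∀ z v, leviForm (fun x => Real.log (leviMatrix φ x).det.re) z v v = 0)
    (z₁ z₂ : Fin n → ℂ) : leviMatrix φ z₁ = leviMatrix φ z₂ := by
  obtain ⟨M, hM⟩ := exists_min_of_lattice_invariant Γ
  have hφ2 : ContDiff ℝ 2 φ := hφ.of_le (by norm_num)
  have hφ3 : ContDiff ℝ 3 φ := hφ.of_le (by norm_num)
  have hPD : ∀ z, (leviMatrix φ z).PosDef := fun z => leviMatrix_posDef hφ2.contDiffAt (hpos z)
  -- the uniform probability measure on a ball of radius `R`
  set R : ℝ := |M| + 1 + ‖z₁‖ + ‖z₂‖ with hR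
  have hRpos : 0 < R := by positivity
  set B : Set (Fin n → ℂ) := ball 0 R with hB
  set ν : Measure (Fin n → ℂ) := (volume B)⁻¹ • volume.restrict B with hν
  have hB0 : volume B ≠ 0 := (measure_ball_pos volume 0 hRpos).ne'
  have hBtop : volume B ≠ ⊤ := measure_ball_lt_top.ne
  have hprob : IsProbabilityMeasure ν := ⟨by
    simp [hν, ENNReal.inv_mul_cancel hB0 hBtop]⟩
  have hac : ν ≪ volume.restrict B := Measure.smul_absolutelyContinuous
  have hae : ∀ᵐ y ∂ν, ‖y‖ ≤ R :=
    hac.ae_le ((ae_restrict_mem measurableSet_ball).mono fun y hy => by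
      simpa using (mem_ball_zero_iff.1 hy).le)
  have hrot : ∀ c : ℂ, ‖c‖ = 1 → MeasurePreserving (fun x : Fin n → ℂ => c • x) ν ν := by
    intro c hc
    have h1 := (measurePreserving_smul_pi (n := n) hc).restrict_preimage
      (s := B) measurableSet_ball
    have h2 : (fun x : Fin n → ℂ => c • x) ⁻¹' B = B := by
      ext x; simp [hB, norm_smul, hc]
    rw [h2] at h1
    exact h1.smul_measure _
  -- pluriharmonic functions equal their averages
  have hmean : ∀ u : (Fin n → ℂ) → ℝ, ContDiff ℝ 2 u → (∀ p v, leviForm u p v v = 0) → ∀ z,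
      ∫ y, u (z + y) ∂ν = u z := by
    intro u hu h0 z
    have := integral_eq_of_circleAverage_eq hrot (hu.integrable_comp_add hae z) (a := u z)
      (Eventually.of_forall fun y => circleAverage_line_eq hu h0 z y)
    simpa using this
  -- the minimum of the difference between `φ` and its average
  have hΦ : ContDiff ℝ 2 fun z => ∫ y, φ (z + y) ∂ν := contDiff_two_integral_add hφ3 hae
  have hψ : ContDiff ℝ 2 fun z => φ z - ∫ y, φ (z + y) ∂ν := hφ2.sub hΦ
  obtain ⟨z₀, hz₀, hmin⟩ := hM _ hψ.continuous (by
    intro l hl z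
    have hshift : ContDiff ℝ 2 fun z => φ (z + l) :=
      hφ2.comp (contDiff_id.add contDiff_const)
    have h1 := hmean _ (hshift.sub hφ2) (hper l hl) z
    rw [integral_sub (hshift.integrable_comp_add hae z) (hφ2.integrable_comp_add hae z)] at h1
    have h2 : ∀ y, z + y + l = z + l + y := fun y => by abel
    simp only [h2] at h1
    linarith)
  -- the averaged Levi matrix
  set a : Matrix (Fin n) (Fin n) ℂ := leviMatrix (fun z => ∫ y, φ (z + y) ∂ν) z₀ with ha
  have hint : ∀ v w, Integrable (fun y => leviForm φ (z₀ + y) v w) ν := fun v w =>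
    (hφ.leviForm v w).integrable_comp_add hae z₀
  have haij : ∀ j k, a j k = ∫ y, leviMatrix φ (z₀ + y) j k ∂ν := fun j k =>
    leviForm_integral_add hφ3 hae _ _ _
  have haPD : a.PosDef := by
    refine leviMatrix_posDef hΦ.contDiffAt fun v hv => ?_
    rw [leviForm_integral_add hφ3 hae]
    have h1 : (∫ y, leviForm φ (z₀ + y) v v ∂ν).re = ∫ y, (leviForm φ (z₀ + y) v v).re ∂ν :=
      (Complex.reCLM.integral_comp_comm (hint v v)).symm
    rw [h1, integral_pos_iff_support_of_nonneg (fun y => (hpos _ _ hv).le) (hint v v).re]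
    have h2 : Function.support (fun y => (leviForm φ (z₀ + y) v v).re) = Set.univ := by
      ext y; simpa using (hpos (z₀ + y) v hv).ne'
    rw [h2]
    simp
  have hdom : (leviMatrix φ z₀ - a).PosSemidef := by
    refine Matrix.PosSemidef.of_dotProduct_mulVec_nonneg
      ((leviMatrix_isHermitian hφ2.contDiffAt).sub haPD.1) fun x => ?_
    rw [Matrix.sub_mulVec, dotProduct_sub, star_dotProduct_leviMatrix hφ2.contDiffAt, ha,
      star_dotProduct_leviMatrix hΦ.contDiffAt,
      ← leviForm_sub hφ2.contDiffAt hΦ.contDiffAt, leviForm_self hψ.contDiffAt]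
    have hm : IsLocalMin (fun z => φ z - ∫ y, φ (z + y) ∂ν) z₀ := Eventually.of_forall hmin
    have h1 := hm.fderiv_fderiv_nonneg hψ (star x)
    have h2 := hm.fderiv_fderiv_nonneg hψ (Complex.I • star x)
    exact Complex.zero_le_real.2 (by linarith)
  -- `log det a ≤ log det g(z₀)`
  have hle : Real.log a.det.re ≤ Real.log (leviMatrix φ z₀).det.re := by
    have h1 := ((hPD z₀).log_det_le haPD).1
    have h2 := (hPD z₀).inv.posSemidef.re_trace_mul_nonneg hdom
    rw [Matrix.mul_sub, Matrix.nonsing_inv_mul _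
      ((Matrix.isUnit_iff_isUnit_det _).1 (hPD z₀).isUnit), Matrix.trace_sub, Matrix.trace_one,
      Complex.sub_re, Complex.natCast_re] at h2
    linarith
  -- the defect in the concavity inequality has nonpositive average
  have htr : Integrable (fun y => (a⁻¹ * leviMatrix φ (z₀ + y)).trace) ν ∧
      ∫ y, (a⁻¹ * leviMatrix φ (z₀ + y)).trace ∂ν = n := by
    have hi : ∀ i k, Integrable (fun y => a⁻¹ i k * leviMatrix φ (z₀ + y) k i) ν := fun i k =>
      (hint _ _).const_mul _
    simp only [Matrix.trace, Matrix.diag_apply, Matrix.mul_apply]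
    refine ⟨integrable_finsetSum _ fun i _ => integrable_finsetSum _ fun k _ => hi i k, ?_⟩
    rw [integral_finsetSum _ fun i _ => integrable_finsetSum _ fun k _ => hi i k]
    have h1 : ∀ i, ∫ y, ∑ k, a⁻¹ i k * leviMatrix φ (z₀ + y) k i ∂ν = (a⁻¹ * a) i i := by
      intro i
      rw [integral_finsetSum _ fun k _ => hi i k, Matrix.mul_apply]
      simp only [integral_const_mul, haij]
    simp only [h1]
    rw [Matrix.nonsing_inv_mul _ ((Matrix.isUnit_iff_isUnit_det _).1 haPD.isUnit)]
    simp
  have hU := contDiff_log_det_leviMatrix hφ hPD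
  set f : (Fin n → ℂ) → ℝ := fun y => Real.log a.det.re +
    ((a⁻¹ * leviMatrix φ (z₀ + y)).trace.re - Fintype.card (Fin n)) -
      Real.log (leviMatrix φ (z₀ + y)).det.re with hf
  have hf0 : ∀ y, 0 ≤ f y := fun y => by
    have := (haPD.log_det_le (hPD (z₀ + y))).1
    simp only [hf]; linarith
  have htri : Integrable (fun y => (a⁻¹ * leviMatrix φ (z₀ + y)).trace.re) ν := htr.1.re
  have hfi1 : Integrable (fun y => (a⁻¹ * leviMatrix φ (z₀ + y)).trace.re -
      (Fintype.card (Fin n) : ℝ)) ν := htri.sub (integrable_const _)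
  have hfi2 : Integrable (fun y => Real.log a.det.re +
      ((a⁻¹ * leviMatrix φ (z₀ + y)).trace.re - (Fintype.card (Fin n) : ℝ))) ν :=
    (integrable_const _).add hfi1
  have hfi : Integrable f ν := hfi2.sub (hU.integrable_comp_add hae z₀)
  have hfint : ∫ y, f y ∂ν ≤ 0 := by
    have h1 : ∫ y, (a⁻¹ * leviMatrix φ (z₀ + y)).trace.re ∂ν = n := by
      have := Complex.reCLM.integral_comp_comm htr.1
      rw [htr.2] at this
      simpa using this
    have h2 : ∫ y, f y ∂ν = Real.log a.det.re - Real.log (leviMatrix φ z₀).det.re := by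
      simp only [hf]
      rw [integral_sub hfi2 (hU.integrable_comp_add hae z₀),
        integral_add (integrable_const _) hfi1, integral_sub htri (integrable_const _),
        hmean _ hU hdet z₀, h1]
      simp
    rw [h2]; linarith
  have hfz : f =ᵐ[ν] 0 :=
    (integral_eq_zero_iff_of_nonneg hf0 hfi).1 (le_antisymm hfint (integral_nonneg hf0))
  have hfc : Continuous f := by
    have hM' : Continuous fun y => leviMatrix φ (z₀ + y) := by
      refine continuous_matrix fun j k => ?_
      exact (hφ.leviForm _ _).continuous.comp (continuous_const.add continuous_id)
    have h1 : Continuous fun y => (a⁻¹ * leviMatrix φ (z₀ + y)).trace.re :=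
      Complex.continuous_re.comp (continuous_const.matrix_mul hM').matrix_trace
    exact (continuous_const.add (h1.sub continuous_const)).sub
      (hU.continuous.comp (continuous_const.add continuous_id))
  have hfB : Set.EqOn f 0 B := by
    have h1 : f =ᵐ[volume.restrict B] 0 :=
      (Measure.absolutelyContinuous_smul (ENNReal.inv_ne_zero.2 hBtop)).ae_le hfz
    exact Measure.eqOn_open_of_ae_eq h1 isOpen_ball hfc.continuousOn continuousOn_const
  have hconst : ∀ z, ‖z‖ ≤ ‖z₁‖ + ‖z₂‖ → leviMatrix φ z = a := by
    intro z hz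
    have hmem : z - z₀ ∈ B := by
      rw [hB, mem_ball_zero_iff]
      have := norm_sub_le z z₀
      have := le_abs_self M
      linarith
    have h1 := hfB hmem
    simp only [hf, add_sub_cancel, Pi.zero_apply] at h1
    exact (haPD.log_det_le (hPD z)).2 (by linarith)
  rw [hconst z₁ (by linarith [norm_nonneg z₂]), hconst z₂ (by linarith [norm_nonneg z₁])]

end Rigidity

/-! ### Pluriharmonic functions as real parts -/

section RealPart

variable {E : Type*} [NormedAddCommGroup E] [NormedSpace ℂ E]

/-- A pluriharmonic function on `E` is the real part of an entire function: the form
`v ↦ du(v) - i du(iv)` is closed, and complex linear, so its primitives are holomorphic. -/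
theorem exists_differentiable_re_eq {u : E → ℝ} (hu : ContDiff ℝ 2 u)
    (h0 : ∀ p v w, leviForm u p v w = 0) :
    ∃ G : E → ℂ, Differentiable ℂ G ∧ ∀ z, (G z).re = u z := by
  set mulI : E →L[ℝ] E := (Complex.I • ContinuousLinearMap.id ℂ E).restrictScalars ℝ with hmulI
  have hmulI_apply : ∀ v, mulI v = Complex.I • v := fun v => rfl
  set A : (E →L[ℝ] ℝ) →L[ℝ] (E →L[ℝ] ℂ) := ContinuousLinearMap.compL ℝ E ℝ ℂ Complex.ofRealCLM
  set B : (E →L[ℝ] ℝ) →L[ℝ] (E →L[ℝ] ℝ) := (ContinuousLinearMap.compL ℝ E E ℝ).flip mulI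
  set T : (E →L[ℝ] ℝ) →L[ℝ] (E →L[ℝ] ℂ) := A - Complex.I • A.comp B
  have hT : ∀ L v, T L v = (L v : ℂ) - Complex.I * (L (Complex.I • v) : ℂ) := fun L v => by
    simp [T, A, B, hmulI_apply]
  have hu1 : ContDiff ℝ 1 (fderiv ℝ u) := hu.fderiv_right (by norm_num)
  have hd1 : Differentiable ℝ (fderiv ℝ u) := hu1.differentiable (by simp)
  have hω : ∀ a, HasFDerivAt (fun z => T (fderiv ℝ u z)) (T.comp (fderiv ℝ (fderiv ℝ u) a)) a :=
    fun a => T.hasFDerivAt.comp a (hd1 a).hasFDerivAt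
  obtain ⟨G, hG⟩ := convex_univ.exists_forall_hasFDerivAt_of_fderiv_symmetric
    (ω := fun z => T (fderiv ℝ u z)) isOpen_univ
    (fun a _ => (hω a).differentiableAt.differentiableWithinAt) (by
      intro a _ x y
      have hs := hu.contDiffAt.isSymmSndFDerivAt (x := a) (by simp)
      have hI : fderiv ℝ (fderiv ℝ u) a x (Complex.I • y) =
          fderiv ℝ (fderiv ℝ u) a (Complex.I • x) y := by
        have h1 := h0 a x y
        rw [leviForm_eq hu.contDiffAt] at h1
        have h2 := (mul_eq_zero.1 h1).resolve_left (by norm_num)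
        have h3 := congrArg Complex.im h2
        simp only [Complex.add_im, Complex.ofReal_im, Complex.mul_im, Complex.I_re, Complex.I_im,
          Complex.ofReal_re, Complex.zero_im] at h3
        linarith
      rw [(hω a).fderiv]
      simp only [ContinuousLinearMap.comp_apply, hT]
      rw [hs x y, hI, hs (Complex.I • x) y])
  have hGd : Differentiable ℂ G := fun a => by
    rw [differentiableAt_iff_restrictScalars ℝ (hG a trivial).differentiableAt]
    refine ⟨{ toFun := fun v => T (fderiv ℝ u a) v
              map_add' := fun v w => map_add _ v w
              map_smul' := fun c v => ?_
              cont := (T (fderiv ℝ u a)).continuous }, ?_⟩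
    · have h1 : c • v = c.re • v + c.im • (Complex.I • v) := by
        conv_lhs => rw [← Complex.re_add_im c]
        rw [add_smul, mul_smul]
        simp [Complex.coe_smul]
      have h2 : Complex.I • Complex.I • v = -v := by rw [smul_smul, Complex.I_mul_I]; simp
      have h3 : T (fderiv ℝ u a) (Complex.I • v) = Complex.I * T (fderiv ℝ u a) v := by
        rw [hT, hT, h2, map_neg]
        push_cast
        linear_combination (fderiv ℝ u a (Complex.I • v) : ℂ) * Complex.I_mul_I
      rw [h1, map_add, map_smul, map_smul, h3, RingHom.id_apply, smul_eq_mul]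
      conv_rhs => rw [← Complex.re_add_im c]
      simp only [Complex.real_smul]
      ring
    · rw [(hG a trivial).fderiv]
      ext v
      rfl
  have hconst : ∀ z, (G z).re - u z = (G 0).re - u 0 := by
    have hd : ∀ z, HasFDerivAt (fun z => (G z).re - u z) (0 : E →L[ℝ] ℝ) z := fun z => by
      have h1 := (Complex.reCLM.hasFDerivAt.comp z (hG z trivial)).sub
        (hu.differentiable (by simp) z).hasFDerivAt
      refine h1.congr_fderiv ?_
      ext v
      simp [hT]
    intro z
    exact is_const_of_fderiv_eq_zero (𝕜 := ℝ) (fun z => (hd z).differentiableAt)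
      (fun z => (hd z).fderiv) z 0
  refine ⟨fun z => G z - ((G 0).re - u 0 : ℝ), hGd.sub_const _, fun z => ?_⟩
  have := hconst z
  simp only [Complex.sub_re, Complex.ofReal_re]
  linarith

end RealPart

/-! ### Hermitian quadratic forms -/

section HermitianSquare

variable {n : ℕ}

theorem leviForm_norm_sq_complex (z v w : ℂ) :
    leviForm (fun x : ℂ => ‖x‖ ^ 2) z v w = v * (starRingEnd ℂ) w := by
  have hc : ContDiffAt ℝ 2 (fun x : ℂ => ‖x‖ ^ 2) z := (contDiff_norm_sq ℝ).contDiffAt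
  have h : ∀ a b : ℂ, fderiv ℝ (fderiv ℝ (fun x : ℂ => ‖x‖ ^ 2)) z a b =
      2 * (a.re * b.re + a.im * b.im) := by
    intro a b
    have h1 : fderiv ℝ (fun x : ℂ => ‖x‖ ^ 2) = fun x => (2 : ℝ) • innerSL ℝ x := by
      ext x; simp [fderiv_norm_sq_apply, two_smul]
    have h2 : HasFDerivAt (fun x : ℂ => (2 : ℝ) • innerSL ℝ x) ((2 : ℝ) • innerSL ℝ) z :=
      ((innerSL ℝ (E := ℂ)).hasFDerivAt (x := z)).fun_const_smul (2 : ℝ)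
    rw [h1, h2.fderiv]
    have h3 : innerSL ℝ a b = a.re * b.re + a.im * b.im := by
      rw [innerSL_apply_apply, Complex.inner]
      simp
      ring
    simp [h3]
  rw [leviForm_eq hc, h, h, h, h]
  apply Complex.ext <;> simp <;> ring

theorem contDiff_sum_norm_sq {ι : Type*} (s : Finset ι) {E : Type*} [NormedAddCommGroup E]
    [NormedSpace ℂ E] (L : ι → E →L[ℂ] ℂ) {k : WithTop ℕ∞} :
    ContDiff ℝ k fun z => ∑ i ∈ s, ‖L i z‖ ^ 2 :=
  ContDiff.sum fun i _ => (contDiff_norm_sq ℝ).comp ((L i).restrictScalars ℝ).contDiff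

theorem leviForm_sum {ι : Type*} (s : Finset ι) {E : Type*} [NormedAddCommGroup E]
    [NormedSpace ℂ E] {f : ι → E → ℝ} {z : E} (hf : ∀ i, ContDiffAt ℝ 2 (f i) z) (v w : E) :
    leviForm (fun z => ∑ i ∈ s, f i z) z v w = ∑ i ∈ s, leviForm (f i) z v w := by
  induction s using Finset.cons_induction with
  | empty => simpa using leviForm_const 0 z v w
  | cons a s ha ih =>
    simp only [Finset.sum_cons]
    rw [leviForm_add (hf a) (ContDiffAt.sum fun i _ => hf i), ih]

theorem leviForm_sum_norm_sq {ι : Type*} (s : Finset ι) {E : Type*} [NormedAddCommGroup E]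
    [NormedSpace ℂ E] (L : ι → E →L[ℂ] ℂ) (z v w : E) :
    leviForm (fun z => ∑ i ∈ s, ‖L i z‖ ^ 2) z v w =
      ∑ i ∈ s, L i v * (starRingEnd ℂ) (L i w) := by
  have h : ∀ i, ContDiffAt ℝ 2 (fun z => ‖L i z‖ ^ 2) z := fun i =>
    ((contDiff_norm_sq ℝ).comp ((L i).restrictScalars ℝ).contDiff).contDiffAt
  rw [leviForm_sum s h]
  refine Finset.sum_congr rfl fun i _ => ?_
  rw [leviForm_comp (f := fun x : ℂ => ‖x‖ ^ 2) (F := L i) (contDiff_norm_sq ℝ).contDiffAt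
    (L i).contDiff.contDiffAt, leviForm_norm_sq_complex, (L i).fderiv]

/-- The `i`-th coordinate of `z ↦ P z`. -/
noncomputable def rowCLM (P : Matrix (Fin n) (Fin n) ℂ) (i : Fin n) : (Fin n → ℂ) →L[ℂ] ℂ :=
  LinearMap.toContinuousLinearMap ((LinearMap.proj i).comp P.mulVecLin)

@[simp] theorem rowCLM_apply (P : Matrix (Fin n) (Fin n) ℂ) (i : Fin n) (z : Fin n → ℂ) :
    rowCLM P i z = P.mulVec z i := rfl

open scoped ComplexOrder in
/-- A function on `ℂⁿ` with constant positive definite Levi form is a Hermitian square plus the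
real part of an entire function. -/
theorem exists_sum_norm_sq_add_re {φ : (Fin n → ℂ) → ℝ} (hφ : ContDiff ℝ 2 φ)
    (hpos : (leviMatrix φ 0).PosDef) (hconst : ∀ z, leviMatrix φ z = leviMatrix φ 0) :
    ∃ P : Matrix (Fin n) (Fin n) ℂ, P.det ≠ 0 ∧ ∃ G : (Fin n → ℂ) → ℂ, Differentiable ℂ G ∧
      ∀ z, φ z = ∑ i, ‖P.mulVec z i‖ ^ 2 + (G z).re := by
  obtain ⟨Q, hQ⟩ := hpos.posSemidef.exists_eq_conjTranspose_mul_self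
  have hQdet : Q.det ≠ 0 := fun h => by
    have h1 := hpos.det_pos
    rw [hQ, Matrix.det_mul, h, mul_zero] at h1
    exact lt_irrefl _ h1
  set P : Matrix (Fin n) (Fin n) ℂ := Q.map (starRingEnd ℂ) with hP
  have hPdet : P.det ≠ 0 := by
    have : P.det = (starRingEnd ℂ) Q.det := (RingHom.map_det _ _).symm
    rw [this]
    exact (map_ne_zero _).2 hQdet
  have hq := contDiff_sum_norm_sq (k := 2) Finset.univ (rowCLM P)
  have hzero : ∀ z v w, leviForm (fun z => φ z - ∑ i, ‖rowCLM P i z‖ ^ 2) z v w = 0 := by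
    intro z v w
    rw [leviForm_sub hφ.contDiffAt hq.contDiffAt, leviForm_sum_norm_sq,
      leviForm_eq_sum hφ.contDiffAt, hconst, hQ, sub_eq_zero]
    have hR : ∀ i, rowCLM P i v * (starRingEnd ℂ) (rowCLM P i w) =
        ∑ j, ∑ k, v j * (starRingEnd ℂ) (w k) * (star (Q i j) * Q i k) := fun i => by
      simp only [rowCLM_apply, Matrix.mulVec, dotProduct, map_sum, Finset.sum_mul_sum, hP,
        Matrix.map_apply, map_mul, Complex.conj_conj]
      refine Finset.sum_congr rfl fun j _ => Finset.sum_congr rfl fun k _ => ?_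
      rw [starRingEnd_apply, starRingEnd_apply]
      ring
    simp only [hR, Matrix.mul_apply, Matrix.conjTranspose_apply, Finset.mul_sum]
    rw [Finset.sum_comm]
    conv_rhs => rw [Finset.sum_comm]; enter [2, k]; rw [Finset.sum_comm]
    rw [Finset.sum_comm]
  obtain ⟨G, hG, hGre⟩ := exists_differentiable_re_eq (hφ.sub hq) hzero
  refine ⟨P, hPdet, G, hG, fun z => ?_⟩
  rw [hGre]
  simp

end HermitianSquare

/-! ### Biholomorphisms between the covering, the Siegel domain and the ball -/

section Biholomorphism

variable {E : Type*} [NormedAddCommGroup E] [NormedSpace ℂ E] {F F' : E → E} {S T U : Set E}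

theorem IsBiholomorphism.comp (hF' : IsBiholomorphism F' T U) (hF : IsBiholomorphism F S T) :
    IsBiholomorphism (fun x => F' (F x)) S U := by
  obtain ⟨hFd, hFm, G, hGd, hGm, hGF, hFG⟩ := hF
  obtain ⟨hFd', hFm', G', hGd', hGm', hGF', hFG'⟩ := hF'
  refine ⟨hFd'.comp hFd hFm, hFm'.comp hFm, fun x => G (G' x), hGd.comp hGd' hGm',
    hGm.comp hGm', fun x hx => ?_, fun x hx => ?_⟩
  · simp only [hGF' (hFm hx), hGF hx]
  · simp only [hFG (hGm' hx), hFG' hx]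

theorem IsBiholomorphism.exists_symm (hF : IsBiholomorphism F S T) :
    ∃ G, IsBiholomorphism G T S ∧ Set.LeftInvOn G F S ∧ Set.LeftInvOn F G T := by
  obtain ⟨hFd, hFm, G, hGd, hGm, hGF, hFG⟩ := hF
  exact ⟨G, ⟨hGd, hGm, F, hFd, hFm, hFG, hGF⟩, hGF, hFG⟩

theorem IsBiholomorphism.image_eq (hF : IsBiholomorphism F S T) : F '' S = T := by
  obtain ⟨hFd, hFm, G, hGd, hGm, hGF, hFG⟩ := hF
  exact Set.Subset.antisymm hFm.image_subset fun y hy => ⟨G y, hGm hy, hFG hy⟩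

theorem IsBiholomorphism.injOn (hF : IsBiholomorphism F S T) : Set.InjOn F S := by
  obtain ⟨hFd, hFm, G, hGd, hGm, hGF, hFG⟩ := hF
  exact hGF.injOn

/-- The derivatives of a biholomorphism and of its inverse are inverse to each other. -/
theorem fderiv_comp_fderiv_of_leftInvOn (hS : IsOpen S) (hT : IsOpen T) {G : E → E}
    (hF : DifferentiableOn ℂ F S) (hFm : Set.MapsTo F S T) (hG : DifferentiableOn ℂ G T)
    (hGF : Set.LeftInvOn G F S) {x : E} (hx : x ∈ S) :
    (fderiv ℂ G (F x)).comp (fderiv ℂ F x) = ContinuousLinearMap.id ℂ E := by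
  have h1 := ((hG.differentiableAt (hT.mem_nhds (hFm hx))).hasFDerivAt.comp x
    (hF.differentiableAt (hS.mem_nhds hx)).hasFDerivAt)
  have h2 : G ∘ F =ᶠ[𝓝 x] id := by
    filter_upwards [hS.mem_nhds hx] with y hy using hGF hy
  exact (h1.congr_of_eventuallyEq h2.symm).unique (hasFDerivAt_id x)

theorem det_fderiv_mul_det_fderiv_of_leftInvOn (hS : IsOpen S) (hT : IsOpen T) {G : E → E}
    (hF : DifferentiableOn ℂ F S) (hFm : Set.MapsTo F S T) (hG : DifferentiableOn ℂ G T)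
    (hGF : Set.LeftInvOn G F S) {x : E} (hx : x ∈ S) :
    (fderiv ℂ G (F x)).det * (fderiv ℂ F x).det = 1 := by
  have h := congrArg (fun L : E →L[ℂ] E => LinearMap.det (L : E →ₗ[ℂ] E))
    (fderiv_comp_fderiv_of_leftInvOn hS hT hF hFm hG hGF hx)
  simp only [ContinuousLinearMap.coe_id, LinearMap.det_id] at h
  rw [ContinuousLinearMap.det, ContinuousLinearMap.det, ← LinearMap.det_comp]
  exact h

end Biholomorphism

section Siegel

variable {n : ℕ}

/-- The Siegel domain `{(u, z) | |z|² < Im u}`, an unbounded realization of the ball. -/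
def siegelDomain (n : ℕ) : Set (CSpace n) := {p | ∑ i, ‖p.2 i‖ ^ 2 < p.1.im}

theorem isOpen_siegelDomain : IsOpen (siegelDomain n) :=
  isOpen_lt (by fun_prop) (by fun_prop)

theorem isOpen_unitBall : IsOpen (unitBall n) :=
  isOpen_lt (by fun_prop) (by fun_prop)

/-- The Cayley transform `(w, z) ↦ (i(1+w)/(1-w), z/(1-w))` maps the ball onto the Siegel domain. -/
theorem exists_cayley : ∃ C : CSpace n → CSpace n,
    IsBiholomorphism C (unitBall n) (siegelDomain n) ∧ C 0 = (Complex.I, 0) := by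
  have h1 : ∀ p ∈ unitBall n, (1 : ℂ) - p.1 ≠ 0 := by
    intro p hp h
    have h2 : p.1 = 1 := (sub_eq_zero.1 h).symm
    have h3 : ‖p.1‖ ^ 2 + ∑ i, ‖p.2 i‖ ^ 2 < 1 := hp
    rw [h2] at h3
    have h4 : 0 ≤ ∑ i, ‖p.2 i‖ ^ 2 := Finset.sum_nonneg fun i _ => by positivity
    simp only [norm_one] at h3
    linarith
  have h2 : ∀ p ∈ siegelDomain n, p.1 + Complex.I ≠ 0 := by
    intro p hp h
    have h3 : ∑ i, ‖p.2 i‖ ^ 2 < p.1.im := hp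
    have h4 : 0 ≤ ∑ i, ‖p.2 i‖ ^ 2 := Finset.sum_nonneg fun i _ => by positivity
    have h5 := congrArg Complex.im h
    simp at h5
    linarith
  have hI := Complex.I_sq
  refine ⟨fun p => (Complex.I * (1 + p.1) / (1 - p.1), fun i => p.2 i / (1 - p.1)),
    ⟨?_, ?_, fun p => ((p.1 - Complex.I) / (p.1 + Complex.I),
      fun i => 2 * Complex.I * p.2 i / (p.1 + Complex.I)), ?_, ?_, ?_, ?_⟩, ?_⟩
  · intro p hp
    have := h1 p hp
    refine DifferentiableAt.differentiableWithinAt (DifferentiableAt.prodMk ?_ ?_)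
    · fun_prop (disch := assumption)
    · rw [differentiableAt_pi]
      intro i
      fun_prop (disch := assumption)
  · intro p hp
    have hne := h1 p hp
    have hlt : ‖p.1‖ ^ 2 + ∑ i, ‖p.2 i‖ ^ 2 < 1 := hp
    have hn : 0 < ‖1 - p.1‖ ^ 2 := by positivity
    have him : (Complex.I * (1 + p.1) / (1 - p.1)).im = (1 - ‖p.1‖ ^ 2) / ‖1 - p.1‖ ^ 2 := by
      rw [Complex.div_im, ← Complex.normSq_eq_norm_sq, ← Complex.normSq_eq_norm_sq, ← sub_div]
      congr 1
      simp [Complex.normSq_apply]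
      ring
    simp only [siegelDomain, Set.mem_ofPred_eq]
    rw [him]
    simp only [norm_div, div_pow]
    rw [← Finset.sum_div]
    gcongr
    linarith
  · intro p hp
    have := h2 p hp
    refine DifferentiableAt.differentiableWithinAt (DifferentiableAt.prodMk ?_ ?_)
    · fun_prop (disch := assumption)
    · rw [differentiableAt_pi]
      intro i
      fun_prop (disch := assumption)
  · intro p hp
    have hne := h2 p hp
    have hlt : ∑ i, ‖p.2 i‖ ^ 2 < p.1.im := hp
    have hn : 0 < ‖p.1 + Complex.I‖ ^ 2 := by positivity
    have hid : ‖p.1 + Complex.I‖ ^ 2 = ‖p.1 - Complex.I‖ ^ 2 + 4 * p.1.im := by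
      rw [← Complex.normSq_eq_norm_sq, ← Complex.normSq_eq_norm_sq]
      simp [Complex.normSq_apply]
      ring
    simp only [unitBall, Set.mem_ofPred_eq, norm_div, norm_mul, div_pow, mul_pow, Complex.norm_I,
      Complex.norm_ofNat]
    rw [← Finset.sum_div, ← Finset.mul_sum, ← add_div, div_lt_one hn, hid]
    linarith
  · intro p hp
    have hne := h1 p hp
    have hI0 := Complex.I_ne_zero
    have h3 : Complex.I * (1 + p.1) / (1 - p.1) + Complex.I = 2 * Complex.I / (1 - p.1) := by
      field_simp; ring
    have h4 : Complex.I * (1 + p.1) / (1 - p.1) - Complex.I = 2 * Complex.I * p.1 / (1 - p.1) := by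
      field_simp; ring
    ext i
    · simp only [h3, h4]; field_simp
    · simp only [h3]; field_simp
  · intro p hp
    have hne := h2 p hp
    have hI0 := Complex.I_ne_zero
    have h3 : 1 - (p.1 - Complex.I) / (p.1 + Complex.I) = 2 * Complex.I / (p.1 + Complex.I) := by
      field_simp; ring
    have h4 : 1 + (p.1 - Complex.I) / (p.1 + Complex.I) = 2 * p.1 / (p.1 + Complex.I) := by
      field_simp; ring
    ext i
    · simp only [h3, h4]; field_simp
    · simp only [h3]; field_simp
  · ext <;> simp

/-- The Jacobian of a map of block triangular form. -/
theorem det_fderiv_triangular {c : ℂ} (hc : c ≠ 0) (M : Matrix (Fin n) (Fin n) ℂ) (b : Fin n → ℂ)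
    {g : (Fin n → ℂ) → ℂ} (hg : Differentiable ℂ g) (p : CSpace n) :
    (fderiv ℂ (fun p : CSpace n => ((c * p.1 + g p.2, M.mulVec p.2 + b) : CSpace n)) p).det =
      c * M.det := by
  set M' : (Fin n → ℂ) →L[ℂ] (Fin n → ℂ) := LinearMap.toContinuousLinearMap M.mulVecLin
  set fst := ContinuousLinearMap.fst ℂ ℂ (Fin n → ℂ)
  set snd := ContinuousLinearMap.snd ℂ ℂ (Fin n → ℂ)
  have hd : HasFDerivAt (fun p : CSpace n => ((c * p.1 + g p.2, M.mulVec p.2 + b) : CSpace n))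
      ((c • fst + (fderiv ℂ g p.2).comp snd).prod (M'.comp snd)) p := by
    have h1 : HasFDerivAt (fun p : CSpace n => c * p.1) (c • fst) p :=
      (hasFDerivAt_fst (p := p)).const_mul c
    have h2 : HasFDerivAt (fun p : CSpace n => g p.2) ((fderiv ℂ g p.2).comp snd) p :=
      (hg p.2).hasFDerivAt.comp p hasFDerivAt_snd
    have h3 : HasFDerivAt (fun p : CSpace n => M' p.2) (M'.comp snd) p :=
      M'.hasFDerivAt.comp p hasFDerivAt_snd
    exact (h1.add h2).prodMk (h3.add_const b)
  rw [hd.fderiv]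
  -- the derivative is a transvection followed by a block diagonal map
  have hcomp : (((c • fst + (fderiv ℂ g p.2).comp snd).prod (M'.comp snd) :
      CSpace n →L[ℂ] CSpace n) : CSpace n →ₗ[ℂ] CSpace n) =
      (LinearMap.prodMap (c • LinearMap.id) M.mulVecLin) ∘ₗ
        LinearMap.transvection (c⁻¹ • ((fderiv ℂ g p.2).comp snd : CSpace n →ₗ[ℂ] ℂ))
          ((1, 0) : CSpace n) := by
    refine LinearMap.ext fun v => ?_
    simp only [LinearMap.comp_apply, LinearMap.transvection.apply]
    ext i
    · simp [fst, snd]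
      field_simp
    · simp [fst, snd, M']
  rw [ContinuousLinearMap.det, hcomp, LinearMap.det_comp, LinearMap.transvection.det,
    LinearMap.det_prodMap, LinearMap.det_smul]
  simp [snd, ← Matrix.toLin'_apply']

/-- An automorphism of the Siegel domain moving a given point `q` to `(i, 0)`; its Jacobian is a
power of `Im u - |z|²` at `q`. -/
theorem exists_siegel_automorphism {q : CSpace n} (hq : q ∈ siegelDomain n) :
    ∃ B : CSpace n → CSpace n, IsBiholomorphism B (siegelDomain n) (siegelDomain n) ∧
      B q = (Complex.I, 0) ∧
      ‖(fderiv ℂ B q).det‖ ^ 2 = ((q.1.im - ∑ i, ‖q.2 i‖ ^ 2) ^ (n + 2))⁻¹ := by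
  have hpos : 0 < q.1.im - ∑ i, ‖q.2 i‖ ^ 2 := sub_pos.2 hq
  set s : ℝ := Real.sqrt (q.1.im - ∑ i, ‖q.2 i‖ ^ 2) with hs
  have hs0 : 0 < s := Real.sqrt_pos.2 hpos
  have hs2 : s ^ 2 = q.1.im - ∑ i, ‖q.2 i‖ ^ 2 := Real.sq_sqrt hpos.le
  have hsc : (s : ℂ) ≠ 0 := Complex.ofReal_ne_zero.2 hs0.ne'
  set β : (Fin n → ℂ) → ℂ := fun z => ∑ i, z i * (starRingEnd ℂ) (q.2 i) with hβ
  set b2 : ℝ := ∑ i, ‖q.2 i‖ ^ 2 with hb2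
  have hβd : Differentiable ℂ β := by
    simp only [hβ]; fun_prop
  have hβq : β q.2 = b2 := by
    simp only [hβ, hb2, Complex.ofReal_sum]
    refine Finset.sum_congr rfl fun i _ => ?_
    rw [Complex.mul_conj, Complex.normSq_eq_norm_sq]
  have hβs : ∀ z, β (fun i => (s : ℂ)⁻¹ * z i - (s : ℂ)⁻¹ * q.2 i) = (s : ℂ)⁻¹ * (β z - b2) := by
    intro z
    rw [← hβq]
    simp only [hβ, Finset.mul_sum, ← Finset.sum_sub_distrib]
    exact Finset.sum_congr rfl fun i _ => by ring
  have hβs' : ∀ z, β (fun i => (s : ℂ) * z i + q.2 i) = (s : ℂ) * β z + b2 := by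
    intro z
    rw [← hβq]
    simp only [hβ, Finset.mul_sum, ← Finset.sum_add_distrib]
    exact Finset.sum_congr rfl fun i _ => by ring
  have hnorm : ∀ z : Fin n → ℂ, ∑ i, ‖z i - q.2 i‖ ^ 2 =
      ∑ i, ‖z i‖ ^ 2 - 2 * (β z).re + b2 := by
    intro z
    simp only [hβ, hb2, Complex.re_sum, Finset.mul_sum, ← Finset.sum_sub_distrib,
      ← Finset.sum_add_distrib]
    refine Finset.sum_congr rfl fun i _ => ?_
    simp only [← Complex.normSq_eq_norm_sq, Complex.normSq_apply, Complex.sub_re, Complex.sub_im,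
      Complex.mul_re, Complex.conj_re, Complex.conj_im]
    ring
  have hnorm' : ∀ z : Fin n → ℂ, ∑ i, ‖(s : ℂ) * z i + q.2 i‖ ^ 2 =
      s ^ 2 * ∑ i, ‖z i‖ ^ 2 + 2 * s * (β z).re + b2 := by
    intro z
    simp only [hβ, hb2, Complex.re_sum, Finset.mul_sum, ← Finset.sum_add_distrib]
    refine Finset.sum_congr rfl fun i _ => ?_
    simp only [← Complex.normSq_eq_norm_sq, Complex.normSq_apply, Complex.add_re, Complex.add_im,
      Complex.mul_re, Complex.mul_im, Complex.conj_re, Complex.conj_im, Complex.ofReal_re,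
      Complex.ofReal_im]
    ring
  -- the Heisenberg translation moving `q` to `(i s², 0)`, followed by the dilation
  -- `(u, z) ↦ (s⁻² u, s⁻¹ z)`
  set g : (Fin n → ℂ) → ℂ := fun z =>
    ((s : ℂ) ^ 2)⁻¹ * (-(q.1.re : ℂ) + Complex.I * b2 - 2 * Complex.I * β z) with hg
  have hgd : Differentiable ℂ g := by
    simp only [hg]; fun_prop
  set B : CSpace n → CSpace n := fun p => (((s : ℂ) ^ 2)⁻¹ * p.1 + g p.2,
    ((s : ℂ)⁻¹ • (1 : Matrix (Fin n) (Fin n) ℂ)).mulVec p.2 + -((s : ℂ)⁻¹ • q.2)) with hB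
  have hB2 : ∀ p i, (B p).2 i = (s : ℂ)⁻¹ * p.2 i - (s : ℂ)⁻¹ * q.2 i := fun p i => by
    simp [hB, Matrix.smul_mulVec, sub_eq_add_neg]
  have hB1 : ∀ p, (B p).1 = ((s : ℂ) ^ 2)⁻¹ * p.1 + g p.2 := fun p => rfl
  have hkey : ∀ p, (B p).1.im - ∑ i, ‖(B p).2 i‖ ^ 2 =
      (s ^ 2)⁻¹ * (p.1.im - ∑ i, ‖p.2 i‖ ^ 2) := by
    intro p
    have h1 : ∑ i, ‖(B p).2 i‖ ^ 2 = (s ^ 2)⁻¹ * ∑ i, ‖p.2 i - q.2 i‖ ^ 2 := by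
      rw [Finset.mul_sum]
      refine Finset.sum_congr rfl fun i _ => ?_
      rw [hB2, ← mul_sub, norm_mul, mul_pow, norm_inv, Complex.norm_real, Real.norm_eq_abs,
        inv_pow, sq_abs]
    have h2 : (B p).1.im = (s ^ 2)⁻¹ * (p.1.im + b2 - 2 * (β p.2).re) := by
      have : (B p).1 = (((s ^ 2)⁻¹ : ℝ) : ℂ) *
          (p.1 + (-(q.1.re : ℂ) + Complex.I * b2 - 2 * Complex.I * β p.2)) := by
        rw [hB1, hg]; push_cast; ring
      rw [this, Complex.im_ofReal_mul]
      congr 1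
      simp
      ring
    rw [h1, h2, hnorm]
    ring
  refine ⟨B, ⟨?_, ?_, fun p => ((s : ℂ) ^ 2 * p.1 + 2 * Complex.I * s * β p.2 + Complex.I * b2 +
    q.1.re, fun i => (s : ℂ) * p.2 i + q.2 i), ?_, ?_, ?_, ?_⟩, ?_, ?_⟩
  · have : Differentiable ℂ B := by
      refine Differentiable.prodMk ?_ ?_
      · fun_prop
      · have : Differentiable ℂ fun p : CSpace n => (s : ℂ)⁻¹ • p.2 - (s : ℂ)⁻¹ • q.2 := by
          fun_prop
        simp [Matrix.smul_mulVec, ← sub_eq_add_neg, this]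
    exact this.differentiableOn
  · intro p hp
    have h := hkey p
    have hp' : 0 < p.1.im - ∑ i, ‖p.2 i‖ ^ 2 := sub_pos.2 hp
    have : 0 < (B p).1.im - ∑ i, ‖(B p).2 i‖ ^ 2 := by rw [h]; positivity
    exact sub_pos.1 this
  · refine Differentiable.differentiableOn (Differentiable.prodMk ?_ ?_)
    · fun_prop
    · rw [differentiable_pi]
      intro i
      fun_prop
  · intro p hp
    have hp' : ∑ i, ‖p.2 i‖ ^ 2 < p.1.im := hp
    simp only [siegelDomain, Set.mem_ofPred_eq]
    rw [hnorm']
    have h2 : ((s : ℂ) ^ 2 * p.1 + 2 * Complex.I * s * β p.2 + Complex.I * b2 + q.1.re).im =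
        s ^ 2 * p.1.im + 2 * s * (β p.2).re + b2 := by
      rw [← Complex.ofReal_pow]
      simp only [Complex.add_im, Complex.im_ofReal_mul]
      simp
    rw [h2]
    have : 0 < s ^ 2 := by positivity
    nlinarith
  · intro p hp
    have h1 : (B p).2 = fun i => (s : ℂ)⁻¹ * p.2 i - (s : ℂ)⁻¹ * q.2 i := funext (hB2 p)
    ext i
    · simp only [h1, hβs, hB1, hg]
      field_simp
      ring
    · simp only [hB2]
      field_simp
      ring
  · intro p hp
    ext i
    · simp only [hB1, hg, hβs']
      field_simp
      ring
    · rw [hB2]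
      field_simp
      ring
  · ext i
    · rw [hB1, hg]
      simp only [hβq]
      have h3 : q.1 = q.1.re + Complex.I * q.1.im := by
        rw [mul_comm]; exact (Complex.re_add_im q.1).symm
      have h4 : ((s : ℂ) ^ 2) = q.1.im - b2 := by exact_mod_cast hs2
      have h5 : (q.1.im - b2 : ℂ) ≠ 0 := by rw [← h4]; exact pow_ne_zero _ hsc
      rw [h4]
      field_simp
      linear_combination h3
    · rw [hB2]; simp
  · rw [hB, det_fderiv_triangular (inv_ne_zero (pow_ne_zero 2 hsc)) _ _ hgd, Matrix.det_smul]
    rw [Matrix.det_one, ← hs2]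
    simp only [Fintype.card_fin, mul_one, norm_mul, norm_inv, norm_pow, Complex.norm_real,
      Real.norm_eq_abs, abs_of_pos hs0]
    rw [← inv_pow, ← inv_pow]
    ring

/-- If `φ` is a Hermitian square plus the real part of an entire function, the domain
`{φ(z) < Im u}` is biholomorphic to the Siegel domain by a map with constant Jacobian. -/
theorem exists_biholomorphism_siegelDomain {φ : (Fin n → ℂ) → ℝ} {P : Matrix (Fin n) (Fin n) ℂ}
    (hP : P.det ≠ 0) {G : (Fin n → ℂ) → ℂ} (hG : Differentiable ℂ G)
    (hφ : ∀ z, φ z = ∑ i, ‖P.mulVec z i‖ ^ 2 + (G z).re) :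
    ∃ Θ : CSpace n → CSpace n,
      IsBiholomorphism Θ {p | -p.1.im + φ p.2 < 0} (siegelDomain n) ∧
      (∀ p, (Θ p).1.im - ∑ i, ‖(Θ p).2 i‖ ^ 2 = p.1.im - φ p.2) ∧
      ∀ p, (fderiv ℂ Θ p).det = P.det := by
  have hPu : IsUnit P.det := isUnit_iff_ne_zero.2 hP
  set g : (Fin n → ℂ) → ℂ := fun z => -(Complex.I * G z) with hg
  have hgd : Differentiable ℂ g := by simp only [hg]; fun_prop
  set Θ : CSpace n → CSpace n := fun p => (1 * p.1 + g p.2, P.mulVec p.2 + 0) with hΘ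
  have him : ∀ p, (Θ p).1.im - ∑ i, ‖(Θ p).2 i‖ ^ 2 = p.1.im - φ p.2 := fun p => by
    simp only [hΘ, hφ, hg, add_zero]
    simp
    ring
  have hlin : ∀ Q : Matrix (Fin n) (Fin n) ℂ, Differentiable ℂ fun z : Fin n → ℂ => Q.mulVec z :=
    fun Q => (LinearMap.toContinuousLinearMap Q.mulVecLin).differentiable
  refine ⟨Θ, ⟨?_, ?_, fun p => (p.1 + Complex.I * G (P⁻¹.mulVec p.2), P⁻¹.mulVec p.2),
    ?_, ?_, ?_, ?_⟩, him, fun p => ?_⟩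
  · refine Differentiable.differentiableOn (Differentiable.prodMk ?_ ?_)
    · fun_prop
    · exact ((hlin P).comp differentiable_snd).add_const _
  · intro p hp
    have hp' : -p.1.im + φ p.2 < 0 := hp
    have := him p
    exact sub_pos.1 (by linarith : 0 < (Θ p).1.im - ∑ i, ‖(Θ p).2 i‖ ^ 2)
  · have h1 : Differentiable ℂ fun p : CSpace n => P⁻¹.mulVec p.2 :=
      (hlin P⁻¹).comp differentiable_snd
    refine Differentiable.differentiableOn (Differentiable.prodMk ?_ h1)
    exact differentiable_fst.add ((hG.comp h1).const_mul _)
  · intro p hp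
    have hp' : ∑ i, ‖p.2 i‖ ^ 2 < p.1.im := hp
    simp only [Set.mem_ofPred_eq, hφ, Matrix.mulVec_mulVec, Matrix.mul_nonsing_inv _ hPu,
      Matrix.one_mulVec]
    simp
    linarith
  · intro p hp
    simp only [hΘ, add_zero, Matrix.mulVec_mulVec, Matrix.nonsing_inv_mul _ hPu,
      Matrix.one_mulVec, hg]
    ext <;> simp
  · intro p hp
    simp only [hΘ, add_zero, Matrix.mulVec_mulVec, Matrix.mul_nonsing_inv _ hPu,
      Matrix.one_mulVec, hg]
    ext <;> simp
  · rw [hΘ, det_fderiv_triangular one_ne_zero P 0 hgd, one_mul]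

end Siegel

/-! ### The Bergman kernel on the diagonal -/

section BergmanKernel

variable {n : ℕ}

/-- The function `k` reproduces the values at `p` of the functions in the Bergman space of `Ω`. -/
def IsPointKernel (Ω : Set (CSpace n)) (p : CSpace n) (k : CSpace n → ℂ) : Prop :=
  MemBergmanSpace Ω k ∧ ∀ f : CSpace n → ℂ, MemBergmanSpace Ω f →
    f p = ∫ x in Ω, f x * (starRingEnd ℂ) (k x)

/-- The Bergman kernel of `Ω` has a value at the diagonal point `(p, p)`, which is `c`. -/
def HasKernelDiag (Ω : Set (CSpace n)) (p : CSpace n) (c : ℝ) : Prop :=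
  ∃ k, IsPointKernel Ω p k ∧ k p = c

/-- Two representing functions reproduce each other. -/
theorem IsPointKernel.apply_self_eq {Ω : Set (CSpace n)} {p : CSpace n} {k k' : CSpace n → ℂ}
    (hk : IsPointKernel Ω p k) (hk' : IsPointKernel Ω p k') : k p = k' p := by
  have h1 : ∀ {f g : CSpace n → ℂ}, IsPointKernel Ω p f → IsPointKernel Ω p g →
      f p = (starRingEnd ℂ) (g p) := by
    intro f g hf hg
    rw [hg.2 f hf.1, hf.2 g hg.1, ← integral_conj]
    congr 1
    ext x
    simp [mul_comm]
  rw [h1 hk hk', ← h1 hk' hk']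

/-- Once all point evaluations are represented, the choice made in the definition of the Bergman
kernel is that of an actual reproducing kernel. -/
theorem bergmanKernel_self_of_hasKernelDiag {Ω : Set (CSpace n)} {c : CSpace n → ℝ}
    (h : ∀ p ∈ Ω, HasKernelDiag Ω p (c p)) {p : CSpace n} (hp : p ∈ Ω) :
    bergmanKernel Ω p p = c p := by
  classical
  have hex : ∃ K, IsBergmanKernel Ω K := by
    choose k hk _ using h
    refine ⟨fun x z => if hz : z ∈ Ω then k z hz x else 0, fun z hz => ?_⟩
    simp only [hz, dite_true]
    exact hk z hz
  obtain ⟨k, hk, hkp⟩ := h p hp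
  have hK : IsPointKernel Ω p fun x => bergmanKernel Ω x p := Classical.epsilon_spec hex p hp
  rw [hK.apply_self_eq hk, hkp]

/-- The real Jacobian of a holomorphic map is the squared modulus of the complex one. -/
theorem abs_det_restrictScalars (L : CSpace n →L[ℂ] CSpace n) :
    |(L.restrictScalars ℝ).det| = ‖L.det‖ ^ 2 := by
  have h : (L.restrictScalars ℝ).det = Algebra.norm ℝ L.det :=
    LinearMap.det_restrictScalars (f := (L : CSpace n →ₗ[ℂ] CSpace n))
  rw [h, Algebra.norm_complex_apply, Complex.normSq_eq_norm_sq, abs_of_nonneg (by positivity)]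

theorem differentiableOn_det_fderiv {F : CSpace n → CSpace n} {S : Set (CSpace n)} (hS : IsOpen S)
    (hF : DifferentiableOn ℂ F S) : DifferentiableOn ℂ (fun x => (fderiv ℂ F x).det) S := by
  set b := Module.finBasis ℂ (CSpace n) with hb
  have h1 : ∀ x, (fderiv ℂ F x).det = ∑ σ : Equiv.Perm _, (σ.sign : ℂ) * ∏ i,
      LinearMap.toContinuousLinearMap (b.coord (σ i)) (fderiv ℂ F x (b i)) := by
    intro x
    rw [ContinuousLinearMap.det, ← LinearMap.det_toMatrix b, Matrix.det_apply']
    simp [LinearMap.toMatrix_apply]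
  simp only [h1]
  refine DifferentiableOn.fun_sum fun σ _ => DifferentiableOn.const_mul ?_ _
  induction (Finset.univ : Finset (Fin (Module.finrank ℂ (CSpace n)))) using
    Finset.cons_induction with
  | empty => simp
  | cons a s ha ih =>
    simp only [Finset.prod_cons]
    exact ((ContinuousLinearMap.differentiable _).comp_differentiableOn
      (differentiableOn_fderiv_apply hS hF _)).mul ih

theorem isAddHaarMeasure_volume_cspace : (volume : Measure (CSpace n)).IsAddHaarMeasure :=
  Measure.prod.instIsAddHaarMeasure (volume : Measure ℂ) (volume : Measure (Fin n → ℂ))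

variable {S T : Set (CSpace n)} {F : CSpace n → CSpace n}

/-- A biholomorphism pulls back square integrable holomorphic functions. -/
theorem MemBergmanSpace.pullback (hS : IsOpen S) (hF : IsBiholomorphism F S T)
    {f : CSpace n → ℂ} (hf : MemBergmanSpace T f) :
    MemBergmanSpace S fun x => (fderiv ℂ F x).det * f (F x) := by
  have hd : DifferentiableOn ℂ (fun x => (fderiv ℂ F x).det * f (F x)) S :=
    (differentiableOn_det_fderiv hS hF.1).mul (hf.1.comp hF.1 hF.2.1)
  refine ⟨hd, ?_⟩
  have := isAddHaarMeasure_volume_cspace (n := n)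
  rw [memLp_two_iff_integrable_sq_norm (hd.continuousOn.aestronglyMeasurable hS.measurableSet)]
  have h1 : IntegrableOn (fun x => ‖f x‖ ^ 2) (F '' S) := by
    rw [hF.image_eq]
    exact hf.2.integrable_norm_pow (by norm_num)
  rw [integrableOn_image_iff_integrableOn_abs_det_fderiv_smul volume hS.measurableSet
    (f' := fun x => (fderiv ℂ F x).restrictScalars ℝ)
    (fun x hx => ((hF.1.differentiableAt (hS.mem_nhds hx)).hasFDerivAt.restrictScalars
      ℝ).hasFDerivWithinAt) hF.injOn] at h1
  refine h1.congr_fun (fun x _ => ?_) hS.measurableSet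
  simp only [abs_det_restrictScalars, smul_eq_mul, norm_mul, mul_pow]

/-- The transformation rule of the Bergman kernel. -/
theorem HasKernelDiag.pullback (hS : IsOpen S) (hT : IsOpen T) (hF : IsBiholomorphism F S T)
    {p : CSpace n} (hp : p ∈ S) {c : ℝ} (h : HasKernelDiag T (F p) c) :
    HasKernelDiag S p (‖(fderiv ℂ F p).det‖ ^ 2 * c) := by
  have := isAddHaarMeasure_volume_cspace (n := n)
  obtain ⟨k, ⟨hkm, hkr⟩, hkp⟩ := h
  obtain ⟨G, hG, hGF, hFG⟩ := hF.exists_symm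
  have hdet : ∀ x ∈ S, (fderiv ℂ G (F x)).det * (fderiv ℂ F x).det = 1 := fun x hx =>
    det_fderiv_mul_det_fderiv_of_leftInvOn hS hT hF.1 hF.2.1 hG.1 hGF hx
  have hmem := hkm.pullback hS hF
  refine ⟨fun x => (starRingEnd ℂ) (fderiv ℂ F p).det * ((fderiv ℂ F x).det * k (F x)),
    ⟨⟨hmem.1.const_mul _, hmem.2.const_mul _⟩, fun f hf => ?_⟩, ?_⟩
  · have h1 := hkr _ (hf.pullback hT hG)
    rw [← hF.image_eq, integral_image_eq_integral_abs_det_fderiv_smul volume hS.measurableSet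
      (f' := fun x => (fderiv ℂ F x).restrictScalars ℝ)
      (fun x hx => ((hF.1.differentiableAt (hS.mem_nhds hx)).hasFDerivAt.restrictScalars
        ℝ).hasFDerivWithinAt) hF.injOn] at h1
    simp only [hGF hp] at h1
    calc f p = (fderiv ℂ F p).det * ((fderiv ℂ G (F p)).det * f p) := by
          linear_combination (-f p) * hdet p hp
      _ = ∫ x in S, f x * (starRingEnd ℂ)
          ((starRingEnd ℂ) (fderiv ℂ F p).det * ((fderiv ℂ F x).det * k (F x))) := by
        rw [h1, ← integral_const_mul]
        refine setIntegral_congr_fun hS.measurableSet fun x hx => ?_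
        simp only [abs_det_restrictScalars, Complex.real_smul, hGF hx, map_mul, Complex.conj_conj]
        rw [← Complex.normSq_eq_norm_sq, ← Complex.mul_conj]
        linear_combination ((fderiv ℂ F p).det * (starRingEnd ℂ) (fderiv ℂ F x).det * f x *
          (starRingEnd ℂ) (k (F x))) * hdet x hx
  · rw [← Complex.normSq_eq_norm_sq, Complex.ofReal_mul, ← Complex.mul_conj, ← hkp]
    ring

/-- By the mean value property, the Bergman kernel of the ball at its center is the constant
`1 / vol`. -/
theorem exists_hasKernelDiag_unitBall_zero : ∃ c > 0, HasKernelDiag (unitBall n) 0 c := by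
  have hmeas : MeasurableSet (unitBall n) := isOpen_unitBall.measurableSet
  have hsub : unitBall n ⊆ ball (0 : CSpace n) 2 := by
    intro p hp
    have h1 : ‖p.1‖ ^ 2 + ∑ i, ‖p.2 i‖ ^ 2 < 1 := hp
    have h0 : ∀ i, 0 ≤ ‖p.2 i‖ ^ 2 := fun i => by positivity
    have h2 : 0 ≤ ∑ i, ‖p.2 i‖ ^ 2 := Finset.sum_nonneg fun i _ => h0 i
    rw [mem_ball_zero_iff, Prod.norm_def, max_lt_iff, pi_norm_lt_iff (by norm_num)]
    refine ⟨by nlinarith [norm_nonneg p.1], fun i => ?_⟩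
    have h3 := Finset.single_le_sum (fun i _ => h0 i) (Finset.mem_univ i)
    nlinarith [norm_nonneg (p.2 i), norm_nonneg p.1]
  have htop : volume (unitBall n) ≠ ⊤ :=
    ((measure_mono hsub).trans_lt measure_ball_lt_top).ne
  have hmem0 : (0 : CSpace n) ∈ unitBall n := by simp [unitBall]
  have hpos : 0 < volume.real (unitBall n) :=
    ENNReal.toReal_pos (isOpen_unitBall.measure_pos volume ⟨0, hmem0⟩).ne' htop
  have : IsFiniteMeasure (volume.restrict (unitBall n)) := ⟨by simpa using htop.lt_top⟩
  refine ⟨(volume.real (unitBall n))⁻¹, inv_pos.2 hpos,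
    fun _ => (((volume.real (unitBall n))⁻¹ : ℝ) : ℂ),
    ⟨⟨differentiableOn_const _, memLp_const _⟩, fun f hf => ?_⟩, rfl⟩
  have hrot : ∀ c : ℂ, ‖c‖ = 1 → MeasurePreserving (fun x : CSpace n => c • x)
      (volume.restrict (unitBall n)) (volume.restrict (unitBall n)) := by
    intro c hc
    have h1 := (measurePreserving_smul_prod (n := n) hc).restrict_preimage hmeas
    have h2 : (fun x : CSpace n => c • x) ⁻¹' unitBall n = unitBall n := by
      ext x; simp [unitBall, hc]
    rwa [h2] at h1
  have havg : ∀ᵐ x ∂volume.restrict (unitBall n),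
      Real.circleAverage (fun ζ : ℂ => f (ζ • x)) 0 1 = f 0 := by
    refine (ae_restrict_mem hmeas).mono fun x hx => ?_
    have hx' : ‖x.1‖ ^ 2 + ∑ i, ‖x.2 i‖ ^ 2 < 1 := hx
    have hmaps : ∀ ζ : ℂ, ‖ζ‖ ≤ 1 → ζ • x ∈ unitBall n := by
      intro ζ hζ
      have h3 : ‖ζ‖ ^ 2 ≤ 1 := pow_le_one₀ (norm_nonneg _) hζ
      have h4 : 0 ≤ ‖x.1‖ ^ 2 + ∑ i, ‖x.2 i‖ ^ 2 :=
        add_nonneg (by positivity) (Finset.sum_nonneg fun i _ => by positivity)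
      simp only [unitBall, Set.mem_ofPred_eq, Prod.smul_fst, Prod.smul_snd, Pi.smul_apply,
        smul_eq_mul, norm_mul, mul_pow]
      rw [← Finset.mul_sum, ← mul_add]
      nlinarith
    have hd : DiffContOnCl ℂ (fun ζ : ℂ => f (ζ • x)) (ball 0 |1|) := by
      apply DifferentiableOn.diffContOnCl
      rw [abs_one, closure_ball _ one_ne_zero]
      intro ζ hζ
      have h5 : DifferentiableAt ℂ f (ζ • x) :=
        hf.1.differentiableAt (isOpen_unitBall.mem_nhds (hmaps ζ (by simpa using hζ)))
      have h6 : DifferentiableAt ℂ (fun ζ : ℂ => ζ • x) ζ := by fun_prop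
      exact (h5.comp ζ h6).differentiableWithinAt
    simpa using hd.circleAverage
  have hint : Integrable f (volume.restrict (unitBall n)) :=
    hf.2.integrable (by norm_num)
  simp only [Complex.conj_ofReal]
  rw [integral_mul_const, integral_eq_of_circleAverage_eq hrot hint havg,
    measureReal_restrict_apply_univ, Complex.real_smul]
  push_cast
  have : (volume.real (unitBall n) : ℂ) ≠ 0 := Complex.ofReal_ne_zero.2 hpos.ne'
  field_simp

/-- The kernel of the Siegel domain is transported from the center of the ball by the Cayley
transform and the transitive automorphism group. -/
theorem exists_hasKernelDiag_siegelDomain : ∃ c > 0, ∀ q ∈ siegelDomain n,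
    HasKernelDiag (siegelDomain n) q (((q.1.im - ∑ i, ‖q.2 i‖ ^ 2) ^ (n + 2))⁻¹ * c) := by
  obtain ⟨c, hc, hball⟩ := exists_hasKernelDiag_unitBall_zero (n := n)
  obtain ⟨C, hC, hC0⟩ := exists_cayley (n := n)
  have hmem0 : (0 : CSpace n) ∈ unitBall n := by simp [unitBall]
  obtain ⟨G, hG, hGC, hCG⟩ := hC.exists_symm
  have hGI : G (Complex.I, 0) = 0 := by rw [← hC0]; exact hGC hmem0
  have hI : ((Complex.I, 0) : CSpace n) ∈ siegelDomain n := by simp [siegelDomain]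
  have h1 := HasKernelDiag.pullback isOpen_siegelDomain isOpen_unitBall hG hI (hGI.symm ▸ hball)
  have hdet : (fderiv ℂ G (Complex.I, 0)).det ≠ 0 := by
    have := det_fderiv_mul_det_fderiv_of_leftInvOn isOpen_siegelDomain isOpen_unitBall hG.1 hG.2.1
      hC.1 hCG hI
    exact right_ne_zero_of_mul_eq_one this
  refine ⟨‖(fderiv ℂ G (Complex.I, 0)).det‖ ^ 2 * c, mul_pos (by positivity) hc, fun q hq => ?_⟩
  obtain ⟨B, hB, hBq, hBdet⟩ := exists_siegel_automorphism hq
  have h2 := HasKernelDiag.pullback isOpen_siegelDomain isOpen_siegelDomain hB hq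
    (by rw [hBq]; exact h1)
  rwa [hBdet] at h2

end BergmanKernel

/-! ### The metric induced from the ball -/

section BallQuotient

namespace TorusLineBundle

variable {n : ℕ} {Γ : Submodule ℤ (Fin n → ℂ)} {N : TorusLineBundle Γ}

namespace HermitianMetric

theorem contDiff_log_h (ρ : N.HermitianMetric) :
    ContDiff ℝ (⊤ : ℕ∞) fun z => Real.log (ρ.h z) :=
  ρ.smooth.log fun z => (ρ.pos z).ne'

theorem contDiff_log_h_nat (ρ : N.HermitianMetric) (k : ℕ) :
    ContDiff ℝ k fun z => Real.log (ρ.h z) :=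
  ρ.contDiff_log_h.of_le (by exact_mod_cast le_top)

theorem isOpen_cover (ρ : N.HermitianMetric) : IsOpen ρ.cover :=
  isOpen_lt ((Complex.continuous_im.comp continuous_fst).neg.add
    ((ρ.contDiff_log_h_nat 2).continuous.comp continuous_snd)) continuous_const

/-- The curvature of a Ricci-flat negative line bundle metric is constant. -/
theorem leviMatrix_log_h_eq [DiscreteTopology Γ] [IsZLattice ℝ Γ] (ρ : N.HermitianMetric)
    (hneg : ρ.IsNegative) (hric : ρ.IsRicciFlat) (z : Fin n → ℂ) :
    leviMatrix (fun z => Real.log (ρ.h z)) z = leviMatrix (fun z => Real.log (ρ.h z)) 0 := by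
  refine leviMatrix_eq_of_pluriharmonic_log_det Γ (ρ.contDiff_log_h_nat 4) ?_ hneg
    (fun z v => neg_eq_zero.1 (hric z v v)) z 0
  intro l hl z v
  have hne := N.ne_zero ⟨l, hl⟩
  have he : ContDiffAt ℂ 2 (N.e ⟨l, hl⟩) z :=
    contDiffAt_two_of_differentiableOn (N.holomorphic ⟨l, hl⟩).differentiableOn isOpen_univ
      trivial
  have heq : (fun z => Real.log (ρ.h (z + l)) - Real.log (ρ.h z)) =
      fun z => -2 * Real.log ‖N.e ⟨l, hl⟩ z‖ := by
    ext z
    have h1 := ρ.invariant ⟨l, hl⟩ z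
    have h2 : 0 < ‖N.e ⟨l, hl⟩ z‖ := norm_pos_iff.2 (hne z)
    simp only at h1
    rw [← h1, Real.log_mul (ρ.pos _).ne' (by positivity), Real.log_pow]
    push_cast
    ring
  rw [heq, leviForm_const_mul (contDiffAt_log_norm he (hne z)), leviForm_log_norm he (hne z),
    mul_zero]

open scoped ComplexOrder in
/-- The universal cover of the punctured disc bundle is biholomorphic to the ball, and its Bergman
kernel on the diagonal is a multiple of a power of `Im u - log h(z)`. -/
theorem exists_biholomorphism_cover [DiscreteTopology Γ] [IsZLattice ℝ Γ] (ρ : N.HermitianMetric)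
    (hneg : ρ.IsNegative) (hric : ρ.IsRicciFlat) :
    (∃ F, IsBiholomorphism F (unitBall n) ρ.cover) ∧ ∃ c > 0, ∀ q ∈ ρ.cover,
      HasKernelDiag ρ.cover q (((q.1.im - Real.log (ρ.h q.2)) ^ (n + 2))⁻¹ * c) := by
  have hφ2 : ContDiff ℝ 2 fun z => Real.log (ρ.h z) := ρ.contDiff_log_h_nat 2
  obtain ⟨P, hP, G, hG, hPG⟩ := exists_sum_norm_sq_add_re hφ2
    (leviMatrix_posDef hφ2.contDiffAt (hneg 0)) (ρ.leviMatrix_log_h_eq hneg hric)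
  obtain ⟨Θ, hΘ, hΘim, hΘdet⟩ := exists_biholomorphism_siegelDomain hP hG hPG
  have hΘ' : IsBiholomorphism Θ ρ.cover (siegelDomain n) := hΘ
  have hopen := ρ.isOpen_cover
  obtain ⟨C, hC, -⟩ := exists_cayley (n := n)
  obtain ⟨G', hG', -, -⟩ := hΘ'.exists_symm
  obtain ⟨c, hc, hker⟩ := exists_hasKernelDiag_siegelDomain (n := n)
  refine ⟨⟨_, hG'.comp hC⟩, ‖P.det‖ ^ 2 * c, by positivity, fun q hq => ?_⟩
  have h1 := (hker (Θ q) (hΘ'.2.1 hq)).pullback hopen isOpen_siegelDomain hΘ' hq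
  rw [hΘim, hΘdet] at h1
  convert h1 using 1
  ring

/-- The Bergman metric of the ball in terms of any biholomorphism onto the universal cover of the
punctured disc bundle. By the transformation rule the logarithms of the two kernels differ by the
pluriharmonic function `log |det F'|²`. -/
theorem bergmanMetric_unitBall_eq [DiscreteTopology Γ] [IsZLattice ℝ Γ] (ρ : N.HermitianMetric)
    (hneg : ρ.IsNegative) (hric : ρ.IsRicciFlat) {F : CSpace n → CSpace n}
    (hF : IsBiholomorphism F (unitBall n) ρ.cover) {p : CSpace n} (hp : p ∈ unitBall n)
    (v w : CSpace n) :
    bergmanMetric (unitBall n) p v w = leviForm (fun x =>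
      -((n : ℝ) + 2) * Real.log ((F x).1.im - Real.log (ρ.h (F x).2))) p v w := by
  obtain ⟨-, c, hc, hker⟩ := ρ.exists_biholomorphism_cover hneg hric
  have hφ2 : ContDiff ℝ 2 fun z => Real.log (ρ.h z) := ρ.contDiff_log_h_nat 2
  have hopen := ρ.isOpen_cover
  obtain ⟨G, hG, hGF, hFG⟩ := hF.exists_symm
  have hJ0 : ∀ x ∈ unitBall n, (fderiv ℂ F x).det ≠ 0 := fun x hx =>
    right_ne_zero_of_mul_eq_one (det_fderiv_mul_det_fderiv_of_leftInvOn isOpen_unitBall hopen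
      hF.1 hF.2.1 hG.1 hGF hx)
  have hpos : ∀ x ∈ unitBall n, 0 < (F x).1.im - Real.log (ρ.h (F x).2) := fun x hx => by
    have : -(F x).1.im + Real.log (ρ.h (F x).2) < 0 := hF.2.1 hx
    linarith
  -- the transformation rule, with the kernel of `ρ.cover` known explicitly
  have hlog : (fun x => Real.log (bergmanKernel (unitBall n) x x).re) =ᶠ[𝓝 p] fun x =>
      (2 * Real.log ‖(fderiv ℂ F x).det‖ + Real.log c) +
        -((n : ℝ) + 2) * Real.log ((F x).1.im - Real.log (ρ.h (F x).2)) := by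
    filter_upwards [isOpen_unitBall.mem_nhds hp] with x hx
    rw [bergmanKernel_self_of_hasKernelDiag (fun x hx =>
      (hker (F x) (hF.2.1 hx)).pullback isOpen_unitBall hopen hF hx) hx, Complex.ofReal_re]
    have h1 : 0 < ‖(fderiv ℂ F x).det‖ := norm_pos_iff.2 (hJ0 x hx)
    have h2 := hpos x hx
    rw [Real.log_mul (by positivity) (by positivity), Real.log_mul (by positivity) hc.ne',
      Real.log_inv, Real.log_pow, Real.log_pow]
    push_cast
    ring
  have hJ : ContDiffAt ℂ 2 (fun x => (fderiv ℂ F x).det) p :=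
    contDiffAt_two_of_differentiableOn (differentiableOn_det_fderiv isOpen_unitBall hF.1)
      isOpen_unitBall hp
  have hFr : ContDiffAt ℝ 2 F p :=
    (contDiffAt_two_of_differentiableOn hF.1 isOpen_unitBall hp).restrict_scalars ℝ
  have hA : ContDiffAt ℝ 2 (fun x => (F x).1.im - Real.log (ρ.h (F x).2)) p :=
    (Complex.imCLM.contDiff.contDiffAt.comp p (contDiffAt_fst.comp p hFr)).sub
      (hφ2.contDiffAt.comp p (contDiffAt_snd.comp p hFr))
  have hB := contDiffAt_log_norm hJ (hJ0 p hp)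
  have hB2 : ContDiffAt ℝ 2 (fun x => 2 * Real.log ‖(fderiv ℂ F x).det‖) p :=
    contDiffAt_const.mul hB
  unfold bergmanMetric
  rw [hlog.leviForm_eq, leviForm_add (hB2.add contDiffAt_const)
    (contDiffAt_const.mul (hA.log (hpos p hp).ne')), leviForm_add hB2 contDiffAt_const,
    leviForm_const_mul hB, leviForm_log_norm hJ (hJ0 p hp), leviForm_const]
  simp

/-! ### The Calabi Ansatz -/

theorem log_normFun_expCover (ρ : N.HermitianMetric) (q : CSpace n) :
    Real.log (ρ.normFun (expCover q)) = -q.1.im + Real.log (ρ.h q.2) := by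
  have h1 : ‖Complex.exp (Complex.I / 2 * q.1)‖ = Real.exp (-q.1.im / 2) := by
    rw [Complex.norm_exp]
    congr 1
    simp
    ring
  simp only [normFun, expCover]
  rw [h1, Real.log_mul (by positivity) (ρ.pos _).ne', Real.log_pow, Real.log_exp]
  push_cast
  ring

theorem mem_discBundle_iff (ρ : N.HermitianMetric) (p : CSpace n) :
    p ∈ ρ.discBundle ↔ p.1 ≠ 0 ∧ Real.log (ρ.normFun p) < 0 := by
  have hh := ρ.pos p.2
  have h0 : 0 < ρ.normFun p ↔ p.1 ≠ 0 := by
    constructor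
    · rintro h h1
      simp [normFun, h1] at h
    · intro h
      have : 0 < ‖p.1‖ := norm_pos_iff.2 h
      simp only [normFun]
      positivity
  constructor
  · rintro ⟨h1, h2⟩
    exact ⟨h0.1 h1, Real.log_neg h1 h2⟩
  · rintro ⟨h1, h2⟩
    have h3 := h0.2 h1
    exact ⟨h3, (Real.log_neg_iff h3).1 h2⟩

theorem expCover_mem_discBundle (ρ : N.HermitianMetric) {q : CSpace n} (hq : q ∈ ρ.cover) :
    expCover q ∈ ρ.discBundle := by
  rw [mem_discBundle_iff, log_normFun_expCover]
  exact ⟨Complex.exp_ne_zero _, hq⟩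

/-- The map `(u, z) ↦ (e^{iu/2}, z)` is onto the punctured disc bundle: a preimage of `(w, z)` is
given by `u = -2i log w`. -/
theorem exists_expCover_eq (ρ : N.HermitianMetric) {p : CSpace n} (hp : p ∈ ρ.discBundle) :
    ∃ q ∈ ρ.cover, expCover q = p := by
  have hp' := (ρ.mem_discBundle_iff p).1 hp
  have h : expCover ((-2 * Complex.I * Complex.log p.1, p.2) : CSpace n) = p := by
    have h1 : Complex.I / 2 * (-2 * Complex.I * Complex.log p.1) = Complex.log p.1 := by
      linear_combination (-Complex.log p.1) * Complex.I_sq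
    simp only [expCover, h1, Complex.exp_log hp'.1]
  refine ⟨_, ?_, h⟩
  have h2 := ρ.log_normFun_expCover (-2 * Complex.I * Complex.log p.1, p.2)
  rw [h] at h2
  have h3 := hp'.2
  rw [h2] at h3
  exact h3

theorem log_normFun (ρ : N.HermitianMetric) {p : CSpace n} (hp : p.1 ≠ 0) :
    Real.log (ρ.normFun p) = 2 * Real.log ‖p.1‖ + Real.log (ρ.h p.2) := by
  have : 0 < ‖p.1‖ := norm_pos_iff.2 hp
  simp only [normFun]
  rw [Real.log_mul (by positivity) (ρ.pos _).ne', Real.log_pow]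
  push_cast
  ring

theorem contDiffAt_log_normFun (ρ : N.HermitianMetric) {p : CSpace n} (hp : p.1 ≠ 0) :
    ContDiffAt ℝ 2 (fun q => Real.log (ρ.normFun q)) p := by
  have h1 : ContDiffAt ℝ 2 (fun q : CSpace n => 2 * Real.log ‖q.1‖ + Real.log (ρ.h q.2)) p :=
    (contDiffAt_const.mul (contDiffAt_log_norm contDiffAt_fst hp)).add
      ((ρ.contDiff_log_h_nat 2).contDiffAt.comp p contDiffAt_snd)
  refine h1.congr_of_eventuallyEq ?_
  filter_upwards [(continuous_fst.isOpen_preimage _ isOpen_compl_singleton).mem_nhds hp] with q hq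
  exact ρ.log_normFun hq

/-- Away from the zero section `log r = log |w|² + log h`, and the first summand is
pluriharmonic. -/
theorem leviForm_log_normFun (ρ : N.HermitianMetric) {p : CSpace n} (hp : p.1 ≠ 0)
    (v w : CSpace n) :
    leviForm (fun q => Real.log (ρ.normFun q)) p v w = ρ.baseForm p.2 v.2 w.2 := by
  have heq : (fun q => Real.log (ρ.normFun q)) =ᶠ[𝓝 p] fun q : CSpace n =>
      2 * Real.log ‖q.1‖ + Real.log (ρ.h q.2) := by
    filter_upwards [(continuous_fst.isOpen_preimage _ isOpen_compl_singleton).mem_nhds hp]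
      with q hq using ρ.log_normFun hq
  have h1 : ContDiffAt ℂ 2 (fun q : CSpace n => q.1) p := contDiffAt_fst
  have h2 := contDiffAt_log_norm h1 hp
  have h3 : ContDiffAt ℝ 2 (fun q : CSpace n => 2 * Real.log ‖q.1‖) p := contDiffAt_const.mul h2
  have h4 : ContDiffAt ℝ 2 (fun q : CSpace n => Real.log (ρ.h q.2)) p :=
    (ρ.contDiff_log_h_nat 2).contDiffAt.comp p contDiffAt_snd
  rw [heq.leviForm_eq, leviForm_add h3 h4, leviForm_const_mul h2,
    leviForm_log_norm h1 hp, leviForm_comp (f := fun z => Real.log (ρ.h z))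
      (F := fun q : CSpace n => q.2) (ρ.contDiff_log_h_nat 2).contDiffAt contDiffAt_snd]
  simp [baseForm, fderiv_snd]

/-- The function `-(n+2) log |log r|` on the disc bundle. -/
noncomputable def conePotential (ρ : N.HermitianMetric) (p : CSpace n) : ℝ :=
  -((n : ℝ) + 2) * Real.log |Real.log (ρ.normFun p)|

theorem contDiffAt_conePotential (ρ : N.HermitianMetric) {p : CSpace n} (hp : p ∈ ρ.discBundle) :
    ContDiffAt ℝ 2 ρ.conePotential p := by
  have hp' := (ρ.mem_discBundle_iff p).1 hp
  unfold conePotential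
  simp only [Real.log_abs]
  exact contDiffAt_const.mul ((ρ.contDiffAt_log_normFun hp'.1).log hp'.2.ne)

/-- The summand `-log r` of the Calabi potential cancels the pull-back of the metric of the base. -/
theorem calabiMetric_eq (ρ : N.HermitianMetric) {p : CSpace n} (hp : p ∈ ρ.discBundle)
    (v w : CSpace n) : ρ.calabiMetric p v w = leviForm ρ.conePotential p v w := by
  have hp' := (ρ.mem_discBundle_iff p).1 hp
  have h := leviForm_sub (ρ.contDiffAt_conePotential hp) (ρ.contDiffAt_log_normFun hp'.1) v w
  rw [ρ.leviForm_log_normFun hp'.1] at h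
  have h' : leviForm (fun q => calabiPotential n (ρ.normFun q)) p v w = _ := h
  rw [calabiMetric, h']
  ring

theorem conePotential_expCover (ρ : N.HermitianMetric) (q : CSpace n) :
    ρ.conePotential (expCover q) =
      -((n : ℝ) + 2) * Real.log (q.1.im - Real.log (ρ.h q.2)) := by
  rw [conePotential, log_normFun_expCover, Real.log_abs, ← Real.log_neg_eq_log]
  congr 2
  ring

theorem normFun_act (ρ : N.HermitianMetric) (l : Γ) (p : CSpace n) :
    ρ.normFun (N.act l p) = ρ.normFun p := by
  simp only [normFun, act, norm_mul, mul_pow]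
  rw [← ρ.invariant l p.2]
  ring

theorem act_mem_discBundle (ρ : N.HermitianMetric) (l : Γ) {p : CSpace n}
    (hp : p ∈ ρ.discBundle) : N.act l p ∈ ρ.discBundle := by
  simpa only [discBundle, Set.mem_ofPred_eq, normFun_act] using hp

theorem calabiMetric_isTensorOnDiscBundle (ρ : N.HermitianMetric) :
    ρ.IsTensorOnDiscBundle ρ.calabiMetric := by
  intro l p hp v w
  have hd : Differentiable ℂ (N.act l) :=
    (((N.holomorphic l).comp differentiable_snd).mul differentiable_fst).prodMk
      (differentiable_snd.add_const _)
  have hc : ContDiffAt ℂ 2 (N.act l) p :=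
    contDiffAt_two_of_differentiableOn hd.differentiableOn isOpen_univ trivial
  rw [ρ.calabiMetric_eq (ρ.act_mem_discBundle l hp), ρ.calabiMetric_eq hp,
    ← leviForm_comp (ρ.contDiffAt_conePotential (ρ.act_mem_discBundle l hp)) hc]
  simp only [conePotential, normFun_act]
  rfl

end HermitianMetric

end TorusLineBundle

theorem hasFDerivAt_expCover {n : ℕ} (q : CSpace n) :
    HasFDerivAt (expCover : CSpace n → CSpace n)
      ((((Complex.exp (Complex.I / 2 * q.1)) * (Complex.I / 2)) •
        ContinuousLinearMap.fst ℂ ℂ (Fin n → ℂ)).prod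
          (ContinuousLinearMap.snd ℂ ℂ (Fin n → ℂ))) q := by
  have h1 : HasFDerivAt (fun q : CSpace n => Complex.I / 2 * q.1)
      ((Complex.I / 2) • ContinuousLinearMap.fst ℂ ℂ (Fin n → ℂ)) q :=
    (hasFDerivAt_fst (p := q)).const_mul _
  have h2 := h1.cexp
  rw [smul_smul] at h2
  exact h2.prodMk hasFDerivAt_snd

namespace TorusLineBundle

variable {n : ℕ} {Γ : Submodule ℤ (Fin n → ℂ)} {N : TorusLineBundle Γ}

namespace HermitianMetric

/-- The Calabi Ansatz metric pulls back to the Bergman metric under every identification of the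
ball with the universal cover of the punctured disc bundle. -/
theorem calabiMetric_pullback [DiscreteTopology Γ] [IsZLattice ℝ Γ] (ρ : N.HermitianMetric)
    (hneg : ρ.IsNegative) (hric : ρ.IsRicciFlat) {F : CSpace n → CSpace n}
    (hF : IsBiholomorphism F (unitBall n) ρ.cover) {p : CSpace n} (hp : p ∈ unitBall n)
    (v w : CSpace n) :
    ρ.calabiMetric (expCover (F p)) (fderiv ℂ (fun x => expCover (F x)) p v)
      (fderiv ℂ (fun x => expCover (F x)) p w) = bergmanMetric (unitBall n) p v w := by
  have hmem := ρ.expCover_mem_discBundle (hF.2.1 hp)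
  have hexp : Differentiable ℂ (expCover : CSpace n → CSpace n) :=
    fun q => (hasFDerivAt_expCover q).differentiableAt
  have hc : ContDiffAt ℂ 2 (fun x => expCover (F x)) p :=
    contDiffAt_two_of_differentiableOn (hexp.comp_differentiableOn hF.1) isOpen_unitBall hp
  rw [ρ.calabiMetric_eq hmem, ← leviForm_comp (F := fun x => expCover (F x))
    (ρ.contDiffAt_conePotential hmem) hc, ρ.bergmanMetric_unitBall_eq hneg hric hF hp]
  simp only [conePotential_expCover]

/-- The covering map from the ball to the punctured disc bundle is surjective, with surjective
differentials. -/
theorem exists_expCover_comp_eq (ρ : N.HermitianMetric) {F : CSpace n → CSpace n}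
    (hF : IsBiholomorphism F (unitBall n) ρ.cover) {p : CSpace n} (hp : p ∈ ρ.discBundle) :
    ∃ x ∈ unitBall n, expCover (F x) = p ∧
      Function.Surjective (fderiv ℂ (fun x => expCover (F x)) x) := by
  obtain ⟨q, hq, rfl⟩ := ρ.exists_expCover_eq hp
  obtain ⟨G, hG, hGF, hFG⟩ := hF.exists_symm
  have hx := hG.2.1 hq
  refine ⟨G q, hx, by rw [hFG hq], ?_⟩
  have h1 := fderiv_comp_fderiv_of_leftInvOn ρ.isOpen_cover isOpen_unitBall hG.1 hG.2.1 hF.1 hFG hq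
  have h2 := (hasFDerivAt_expCover (F (G q))).comp (G q)
    (hF.1.differentiableAt (isOpen_unitBall.mem_nhds hx)).hasFDerivAt
  have h3 : fderiv ℂ (fun x => expCover (F x)) (G q) = _ := h2.fderiv
  rw [h3, ContinuousLinearMap.coe_comp]
  refine Function.Surjective.comp ?_ ?_
  · intro v
    have hne : Complex.exp (Complex.I / 2 * (F (G q)).1) * (Complex.I / 2) ≠ 0 :=
      mul_ne_zero (Complex.exp_ne_zero _) (by simp)
    refine ⟨((Complex.exp (Complex.I / 2 * (F (G q)).1) * (Complex.I / 2))⁻¹ * v.1, v.2), ?_⟩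
    ext i
    · simp only [ContinuousLinearMap.prod_apply, _root_.smul_apply,
        ContinuousLinearMap.coe_fst', smul_eq_mul]
      rw [mul_inv_cancel_left₀ hne]
    · simp
  · intro v
    exact ⟨fderiv ℂ G q v, congrArg (fun L : CSpace n →L[ℂ] CSpace n => L v) h1⟩

/-- The Calabi Ansatz metric is the only metric on the punctured disc bundle that is induced from
the ball. Uniqueness holds because every tangent vector of the bundle lifts to the ball. -/
theorem isBallQuotientMetric_iff [DiscreteTopology Γ] [IsZLattice ℝ Γ] (ρ : N.HermitianMetric)
    (hneg : ρ.IsNegative) (hric : ρ.IsRicciFlat) (g : CSpace n → CSpace n → CSpace n → ℂ) :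
    ρ.IsBallQuotientMetric g ↔
      ∀ p ∈ ρ.discBundle, ∀ v w : CSpace n, g p v w = ρ.calabiMetric p v w := by
  constructor
  · rintro ⟨-, ⟨F, hF⟩, hg⟩ p hp v w
    obtain ⟨x, hx, rfl, hsurj⟩ := ρ.exists_expCover_comp_eq hF hp
    obtain ⟨v, rfl⟩ := hsurj v
    obtain ⟨w, rfl⟩ := hsurj w
    rw [hg F hF x hx v w, ρ.calabiMetric_pullback hneg hric hF hx]
  · intro hg
    refine ⟨fun l p hp v w => ?_, (ρ.exists_biholomorphism_cover hneg hric).1,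
      fun F hF p hp v w => ?_⟩
    · rw [hg _ (ρ.act_mem_discBundle l hp), hg _ hp, ρ.calabiMetric_isTensorOnDiscBundle l p hp]
    · rw [hg _ (ρ.expCover_mem_discBundle (hF.2.1 hp)), ρ.calabiMetric_pullback hneg hric hF hp]

end HermitianMetric

end TorusLineBundle

end BallQuotient

/-! ### The explicit weight of a bundle in normal form -/

section NormalForm

variable {n : ℕ}

/-- The Levi form of `ζ ↦ (2 Im ζ + k)²` on `ℂ`. -/
theorem leviForm_two_im_add_sq (k : ℝ) (ζ v w : ℂ) :
    leviForm (fun ζ : ℂ => (2 * ζ.im + k) ^ 2) ζ v w = 2 * v * (starRingEnd ℂ) w := by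
  have h1 : ∀ ζ : ℂ, HasFDerivAt (fun ζ : ℂ => (((2 * ζ.im + k) ^ 2 : ℝ) : ℂ))
      (Complex.ofRealCLM.comp ((4 * (2 * ζ.im + k)) • Complex.imCLM)) ζ := fun ζ => by
    have h2 : HasFDerivAt (fun ζ : ℂ => 2 * ζ.im + k) ((2 : ℝ) • Complex.imCLM) ζ :=
      (Complex.imCLM.hasFDerivAt.const_mul 2).add_const k
    refine Complex.ofRealCLM.hasFDerivAt.comp ζ ((h2.pow 2).congr_fderiv ?_)
    ext
    simp
    ring
  have h3 : delbarD (fun ζ : ℂ => (((2 * ζ.im + k) ^ 2 : ℝ) : ℂ)) w = fun ζ : ℂ =>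
      (((2 * ζ.im + k : ℝ) : ℂ)) * (2 * Complex.I * (starRingEnd ℂ) w) := by
    ext ζ
    rw [delbarD, (h1 ζ).fderiv]
    apply Complex.ext <;> simp <;> ring
  have h4 : HasFDerivAt (fun ζ : ℂ => (((2 * ζ.im + k : ℝ) : ℂ)) *
      (2 * Complex.I * (starRingEnd ℂ) w))
      ((2 * Complex.I * (starRingEnd ℂ) w) •
        Complex.ofRealCLM.comp ((2 : ℝ) • Complex.imCLM)) ζ := by
    have h2 : HasFDerivAt (fun ζ : ℂ => 2 * ζ.im + k) ((2 : ℝ) • Complex.imCLM) ζ :=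
      (Complex.imCLM.hasFDerivAt.const_mul 2).add_const k
    exact (Complex.ofRealCLM.hasFDerivAt.comp ζ h2).mul_const _
  rw [leviForm, h3, delD, h4.fderiv]
  apply Complex.ext <;> simp <;> ring

variable {Z : Matrix (Fin n) (Fin n) ℂ} {t : Fin n → ℂ}

/-- The real number `c_a / i`, where `c_a = z_a - z̄_a + i Y_aa - t_a + t̄_a` and `Y = -Im Z`. -/
noncomputable def imCoord (Z : Matrix (Fin n) (Fin n) ℂ) (t z : Fin n → ℂ) (a : Fin n) : ℝ :=
  2 * (z a).im + (-(Z a a).im - 2 * (t a).im)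

/-- The complex sum in the definition of the explicit weight is the real number `-xᵀ Y⁻¹ x`, where
`x` is the vector of imaginary coordinates. -/
theorem explicitWeight_eq (Z : Matrix (Fin n) (Fin n) ℂ) (t z : Fin n → ℂ) :
    explicitWeight Z t z = Real.exp (Real.pi / 2 * (imCoord Z t z ⬝ᵥ
      (Matrix.of fun a b => -(Z a b).im : Matrix (Fin n) (Fin n) ℝ)⁻¹.mulVec (imCoord Z t z))) := by
  have hc : ∀ a, z a - (starRingEnd ℂ) (z a) + Complex.I * ((-(Z a a).im : ℝ) : ℂ) - t a +
      (starRingEnd ℂ) (t a) = Complex.I * (imCoord Z t z a : ℂ) := fun a => by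
    apply Complex.ext <;> simp [imCoord]
    ring
  have hc2 : ∀ (r : ℝ) (x y : ℝ), (r : ℂ) * (Complex.I * x) * (Complex.I * y) =
      ((-(x * (r * y)) : ℝ) : ℂ) := fun r x y => by
    push_cast
    linear_combination (r * x * y : ℂ) * Complex.I_sq
  simp only [explicitWeight, Matrix.of_apply, hc, hc2]
  congr 1
  simp only [← Complex.ofReal_sum, Complex.ofReal_re, dotProduct, Matrix.mulVec, Finset.mul_sum,
    Finset.sum_neg_distrib]
  simp only [Finset.mul_sum, neg_mul, mul_neg, neg_neg, Finset.sum_neg_distrib]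

/-- In coordinates diagonalizing the imaginary part of `Z`, the logarithm of the explicit weight is
a sum of squares of affine functions of the imaginary parts. -/
theorem exists_log_explicitWeight_eq
    (hY : (Matrix.of fun a b => -(Z a b).im : Matrix (Fin n) (Fin n) ℝ).PosDef) :
    ∃ (Q : Matrix (Fin n) (Fin n) ℂ) (k : Fin n → ℝ), Q.det ≠ 0 ∧ ∀ z,
      Real.log (explicitWeight Z t z) =
        Real.pi / 2 * ∑ i, (2 * (rowCLM Q i z).im + k i) ^ 2 := by
  obtain ⟨Q, hQ⟩ := hY.inv.posSemidef.exists_eq_conjTranspose_mul_self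
  have hdet : Q.det ≠ 0 := fun h => by
    have h1 := hY.inv.det_pos
    rw [hQ, Matrix.det_mul, h, mul_zero] at h1
    exact lt_irrefl _ h1
  refine ⟨Q.map Complex.ofRealHom, fun i => ∑ a, Q i a * (-(Z a a).im - 2 * (t a).im), ?_,
    fun z => ?_⟩
  · rw [← RingHom.mapMatrix_apply, ← RingHom.map_det]
    simpa using hdet
  · rw [explicitWeight_eq, Real.log_exp, hQ, ← Matrix.mulVec_mulVec, Matrix.dotProduct_mulVec,
      Matrix.conjTranspose_eq_transpose_of_trivial, Matrix.vecMul_transpose, dotProduct]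
    congr 1
    refine Finset.sum_congr rfl fun i _ => ?_
    rw [← sq]
    congr 1
    simp only [Matrix.mulVec, dotProduct, imCoord, rowCLM_apply, Matrix.map_apply, Complex.im_sum,
      Finset.mul_sum, ← Finset.sum_add_distrib]
    refine Finset.sum_congr rfl fun a _ => ?_
    simp
    ring

theorem contDiff_explicitWeight (Z : Matrix (Fin n) (Fin n) ℂ) (t : Fin n → ℂ) :
    ContDiff ℝ (⊤ : ℕ∞) (explicitWeight Z t) := by
  have h : ∀ a, ContDiff ℝ (⊤ : ℕ∞) fun z : Fin n → ℂ => imCoord Z t z a := fun a =>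
    (contDiff_const.mul (Complex.imCLM.contDiff.comp (contDiff_apply ℝ ℂ a))).add contDiff_const
  rw [funext (explicitWeight_eq Z t)]
  simp only [dotProduct, Matrix.mulVec]
  exact (contDiff_const.mul (ContDiff.sum fun a _ => (h a).mul
    (ContDiff.sum fun b _ => contDiff_const.mul (h b)))).exp

/-- The Levi form of the logarithm of the explicit weight is a constant Hermitian square. -/
theorem exists_leviForm_log_explicitWeight
    (hY : (Matrix.of fun a b => -(Z a b).im : Matrix (Fin n) (Fin n) ℝ).PosDef) :
    ∃ Q : Matrix (Fin n) (Fin n) ℂ, Q.det ≠ 0 ∧ ∀ z v w,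
      leviForm (fun z => Real.log (explicitWeight Z t z)) z v w =
        Real.pi * ∑ i, Q.mulVec v i * (starRingEnd ℂ) (Q.mulVec w i) := by
  obtain ⟨Q, k, hQ, hlog⟩ := exists_log_explicitWeight_eq (t := t) hY
  refine ⟨Q, hQ, fun z v w => ?_⟩
  have hs : ∀ i, ContDiff ℝ 2 fun ζ : ℂ => (2 * ζ.im + k i) ^ 2 := fun i =>
    ((contDiff_const.mul Complex.imCLM.contDiff).add contDiff_const).pow 2
  have h : ∀ i, ContDiffAt ℝ 2 (fun z => (2 * (rowCLM Q i z).im + k i) ^ 2) z := fun i =>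
    ((hs i).comp ((rowCLM Q i).restrictScalars ℝ).contDiff).contDiffAt
  rw [funext hlog, leviForm_const_mul (ContDiffAt.sum fun i _ => h i), leviForm_sum _ h,
    Finset.mul_sum, Finset.mul_sum]
  refine Finset.sum_congr rfl fun i _ => ?_
  rw [leviForm_comp (f := fun ζ : ℂ => (2 * ζ.im + k i) ^ 2) (F := rowCLM Q i)
    (hs i).contDiffAt (rowCLM Q i).contDiff.contDiffAt, leviForm_two_im_add_sq, (rowCLM Q i).fderiv]
  simp only [rowCLM_apply]
  push_cast
  ring

/-- The compatibility of the explicit weight with the multiplier of the `a`-th column of `Z`. The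
translation moves the vector `x` of imaginary coordinates by `-2 Y_{·a}`, so that `xᵀ Y⁻¹ x` changes
by the affine function `-4 x_a + 4 Y_aa`. -/
theorem explicitWeight_add_column (hZ : Z.IsSymm)
    (hY : (Matrix.of fun a b => -(Z a b).im : Matrix (Fin n) (Fin n) ℝ).PosDef) (a : Fin n)
    (z : Fin n → ℂ) :
    explicitWeight Z t (z + fun b => Z b a) *
      ‖Complex.exp (-2 * (Real.pi : ℂ) * Complex.I * (z a - t a))‖ ^ 2 =
      explicitWeight Z t z := by
  set Y : Matrix (Fin n) (Fin n) ℝ := Matrix.of fun a b => -(Z a b).im with hYdef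
  have hYa : Y.mulVec (Pi.single a 1) = fun b => -(Z b a).im := by
    ext b
    simp [hYdef]
  have hinv : Y⁻¹ * Y = 1 := Matrix.nonsing_inv_mul _ hY.det_pos.ne'.isUnit
  have hx : imCoord Z t (z + fun b => Z b a) =
      imCoord Z t z - (2 : ℝ) • Y.mulVec (Pi.single a 1) := by
    ext b
    rw [hYa]
    simp [imCoord]
    ring
  have hsymm : Y⁻¹.transpose = Y⁻¹ := by
    rw [Matrix.transpose_nonsing_inv]
    congr 1
    ext i j
    simp only [hYdef, Matrix.transpose_apply, Matrix.of_apply]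
    rw [hZ.apply i j]
  have hW : Y⁻¹.mulVec (Y.mulVec (Pi.single a 1)) = Pi.single a 1 := by
    rw [Matrix.mulVec_mulVec, hinv, Matrix.one_mulVec]
  have hW2 : ∀ x : Fin n → ℝ, Y.mulVec (Pi.single a 1) ⬝ᵥ Y⁻¹.mulVec x = x a := fun x => by
    rw [Matrix.dotProduct_mulVec, ← Matrix.mulVec_transpose, hsymm, hW]
    simp
  rw [explicitWeight_eq, explicitWeight_eq, Complex.norm_exp, ← Real.exp_nat_mul, ← Real.exp_add,
    hx]
  congr 1
  simp only [← hYdef, Matrix.mulVec_sub, Matrix.mulVec_smul, hW, sub_dotProduct, dotProduct_sub,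
    smul_dotProduct, dotProduct_smul, hW2, dotProduct_single, smul_eq_mul, mul_one]
  rw [hYa]
  simp [imCoord]
  ring

namespace TorusLineBundle

variable {Γ : Submodule ℤ (Fin n → ℂ)}

theorem e_zero (N : TorusLineBundle Γ) (z : Fin n → ℂ) : N.e 0 z = 1 := by
  have h := N.cocycle 0 0 z
  rw [add_zero, Submodule.coe_zero, add_zero] at h
  exact mul_right_cancel₀ (N.ne_zero 0 z) (h.trans (one_mul _).symm)

/-- By the cocycle relation, the compatibility of a weight with the multipliers needs to be checked
on generators of the lattice only. -/
theorem invariant_of_span (N : TorusLineBundle Γ) {h : (Fin n → ℂ) → ℝ} {S : Set (Fin n → ℂ)}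
    (hS : Γ = Submodule.span ℤ S)
    (hgen : ∀ l : Γ, (l : Fin n → ℂ) ∈ S → ∀ z, h (z + l) * ‖N.e l z‖ ^ 2 = h z) (l : Γ)
    (z : Fin n → ℂ) : h (z + l) * ‖N.e l z‖ ^ 2 = h z := by
  let A : AddSubgroup (Fin n → ℂ) :=
    { carrier := {x | ∃ hx : x ∈ Γ, ∀ z, h (z + x) * ‖N.e ⟨x, hx⟩ z‖ ^ 2 = h z}
      zero_mem' := ⟨Γ.zero_mem, fun z => by
        have h1 : N.e ⟨0, Γ.zero_mem⟩ z = 1 := N.e_zero z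
        rw [h1, add_zero]
        simp⟩
      add_mem' := by
        rintro x y ⟨hx, hx'⟩ ⟨hy, hy'⟩
        refine ⟨Γ.add_mem hx hy, fun z => ?_⟩
        have h1 : N.e ⟨y, hy⟩ (z + x) * N.e ⟨x, hx⟩ z = N.e ⟨x + y, Γ.add_mem hx hy⟩ z :=
          N.cocycle ⟨x, hx⟩ ⟨y, hy⟩ z
        rw [← h1, norm_mul, mul_pow, ← hx' z, ← hy' (z + x), add_assoc, mul_assoc]
      neg_mem' := by
        rintro x ⟨hx, hx'⟩
        refine ⟨Γ.neg_mem hx, fun z => ?_⟩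
        have h1 : N.e ⟨-x, Γ.neg_mem hx⟩ (z + -x + x) * N.e ⟨x, hx⟩ (z + -x) =
            N.e (⟨x, hx⟩ + ⟨-x, Γ.neg_mem hx⟩) (z + -x) :=
          N.cocycle ⟨x, hx⟩ ⟨-x, Γ.neg_mem hx⟩ (z + -x)
        have h0 : (⟨x, hx⟩ + ⟨-x, Γ.neg_mem hx⟩ : Γ) = 0 := by
          ext i
          simp
        rw [h0, N.e_zero, neg_add_cancel_right] at h1
        rw [← hx' (z + -x), neg_add_cancel_right, mul_assoc, ← mul_pow, ← norm_mul, mul_comm,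
          mul_comm (N.e ⟨x, hx⟩ _), h1]
        simp }
  have hle : Submodule.span ℤ S ≤ AddSubgroup.toIntSubmodule A := by
    refine Submodule.span_le.2 fun x hx => ?_
    have hxΓ : x ∈ Γ := hS ▸ Submodule.subset_span hx
    exact ⟨hxΓ, hgen ⟨x, hxΓ⟩ hx⟩
  obtain ⟨_, h1⟩ : (l : Fin n → ℂ) ∈ A := hle (hS ▸ l.2)
  exact h1 z

variable {N : TorusLineBundle Γ} {δ : Fin n → ℤ}

/-- The explicit weight as a Hermitian metric on a bundle in normal form. -/
noncomputable def IsNormalForm.hermitianMetric (hN : N.IsNormalForm δ Z t) :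
    N.HermitianMetric where
  h := explicitWeight Z t
  smooth := contDiff_explicitWeight Z t
  pos z := Real.exp_pos _
  invariant := by
    refine N.invariant_of_span hN.span_eq ?_
    rintro l (⟨a, ha⟩ | ⟨a, ha⟩) z
    -- translation by a real vector does not change the imaginary coordinates
    · rw [hN.mult_one a l ha.symm z, ← ha, explicitWeight_eq, explicitWeight_eq]
      have hx : imCoord Z t (z + Pi.single a ((δ a : ℤ) : ℂ)) = imCoord Z t z := by
        ext b
        rcases eq_or_ne b a with rfl | hb
        · simp [imCoord]
        · simp [imCoord, hb]
      rw [hx]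
      simp
    · rw [hN.mult_exp a l ha.symm z, ← ha]
      exact explicitWeight_add_column hN.symm hN.posDef a z

theorem IsNormalForm.isNegative (hN : N.IsNormalForm δ Z t) : hN.hermitianMetric.IsNegative := by
  obtain ⟨Q, hQ, hlevi⟩ := exists_leviForm_log_explicitWeight (t := t) hN.posDef
  intro z v hv
  have h1 : hN.hermitianMetric.baseForm z v v =
      ((Real.pi * ∑ i, ‖Q.mulVec v i‖ ^ 2 : ℝ) : ℂ) := by
    refine (hlevi z v v).trans ?_
    simp only [Complex.mul_conj']
    push_cast
    rfl
  rw [h1, Complex.ofReal_re]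
  have hQv : Q.mulVec v ≠ 0 := fun h0 => hv (Matrix.eq_zero_of_mulVec_eq_zero hQ h0)
  obtain ⟨i, hi⟩ := Function.ne_iff.1 hQv
  refine mul_pos Real.pi_pos (Finset.sum_pos' (fun i _ => sq_nonneg _) ⟨i, Finset.mem_univ i, ?_⟩)
  exact pow_pos (norm_pos_iff.2 hi) 2

theorem IsNormalForm.isRicciFlat (hN : N.IsNormalForm δ Z t) :
    hN.hermitianMetric.IsRicciFlat := by
  obtain ⟨Q, -, hlevi⟩ := exists_leviForm_log_explicitWeight (t := t) hN.posDef
  intro z v w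
  have h1 : ∀ x, hN.hermitianMetric.baseMatrix x = hN.hermitianMetric.baseMatrix 0 := fun x => by
    ext j k
    exact (hlevi x _ _).trans (hlevi 0 _ _).symm
  rw [HermitianMetric.ricciForm]
  simp only [h1]
  rw [leviForm_const, neg_zero]

end TorusLineBundle

end NormalForm

theorem mainTheorem3 (n : ℕ) (Γ : Submodule ℤ (Fin n → ℂ)) [DiscreteTopology Γ] [IsZLattice ℝ Γ]
    (N : TorusLineBundle Γ) :
    (∀ ρ : N.HermitianMetric, ρ.IsNegative → ρ.IsRicciFlat →
      (∀ g : CSpace n → CSpace n → CSpace n → ℂ,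
        ρ.IsBallQuotientMetric g ↔
          ∀ p ∈ ρ.discBundle, ∀ v w : CSpace n, g p v w = ρ.calabiMetric p v w) ∧
      (∀ p ∈ ρ.discBundle, ∀ v w : CSpace n,
        ρ.calabiMetric p v w =
          leviForm (fun q => -((n : ℝ) + 2) * Real.log |Real.log (ρ.normFun q)|) p v w)) ∧
    (∀ (δ : Fin n → ℤ) (Z : Matrix (Fin n) (Fin n) ℂ) (t : Fin n → ℂ),
      N.IsNormalForm δ Z t →
        ∃ ρ : N.HermitianMetric, (∀ z, ρ.h z = explicitWeight Z t z) ∧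
          ρ.IsNegative ∧ ρ.IsRicciFlat) :=
  ⟨fun ρ hneg hric => ⟨ρ.isBallQuotientMetric_iff hneg hric,
    fun _ hp v w => ρ.calabiMetric_eq hp v w⟩,
    fun _ _ _ hN => ⟨hN.hermitianMetric, fun _ => rfl, hN.isNegative, hN.isRicciFlat⟩⟩
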